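/- Let $\Sigma$ be a finite alphabet with two distinct symbols $0,1\in\Sigma$. A partial function $g:\subseteq\Sigma^\omega\to\Sigma^\omega$ is computable if it is computed by a Type-2 Turing machine (a Turing machine with a read-only infinite input tape, finitely many work tapes and a one-way output tape, which has to write infinitely many symbols on every input from $\mathrm{dom}(g)$). For $a_1,\dots,a_k\in\Sigma$ let $\iota(a_1\dots a_k)=110a_10a_20\dots a_k011$; for words let $\langle u_1,\dots,u_n\rangle=\iota(u_1)\dots\iota(u_n)$; for a word $v$ and a finite or infinite sequence $p$ let $v\ll p$ mean that $\iota(v)$ is a subword of $p$, and say that $p$ enumerates the set of words $\{v\mid v\ll p\}$ (tuples of words are coded by $\langle\cdot\rangle$). For $p_i\in\Sigma^\omega$, $\langle p_1,\dots,p_n\rangle=p_1(0)\dots p_n(0)p_1(1)\dots p_n(1)\dots$ and $\langle p_0,p_1,\dots\rangle(\tfrac{(i+j)(i+j+1)}2+j)=p_i(j)$. An effective topological space is a tuple $\mathbf X=(X,\tau,\beta,\nu)$ such that $(X,\tau)$ is a $T_0$-space and $\nu:\subseteq\Sigma^*\to\beta$ is a partial function onto a base $\beta$ of $\tau$. A sequence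 $\langle r,s\rangle$ is a $\Delta$-name of $\mathbf X$ if $r$ enumerates the graph of the characteristic function of $\mathrm{dom}(\nu)$ and $s$ enumerates a set $S\subseteq\mathrm{dom}(\nu)^3$ such that $\nu(u)\cap\nu(v)=\bigcup\{\nu(w)\mid(u,v,w)\in S\}$ for all $u,v\in\mathrm{dom}(\nu)$. For a compact set $K\subseteq X$, a sequence $s$ is a $\tilde\kappa_{\mathbf X}$-name of $K$ if for all words $w$: $w\ll s$ iff every $v\ll w$ satisfies $v\in\mathrm{dom}(\nu)$ and $\nu(v)\cap K\neq\emptyset$, and $K\subseteq\bigcup\{\nu(v)\mid v\ll w\}$. A sequence $\langle r,s\rangle$ is a $\tilde\kappa^\Delta$-name of the pair $(\mathbf X,K)$ if $r$ is a $\Delta$-name of $\mathbf X$ and $s$ is a $\tilde\kappa_{\mathbf X}$-name of $K$. The product $\mathbf X_1\times\mathbf X_2$ is the product space with $\nu\langle u_1,u_2\rangle=\nu_1(u_1)\times\nu_2(u_2)$ for $u_i\in\mathrm{dom}(\nu_i)$; finite products are defined by $\mathbf X_1\times\dots\times\mathbf X_{n+1}=(\mathbf X_1\times\dots\times\mathbf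 X_n)\times\mathbf X_{n+1}$; the countable product $\mathbf X_1\times\mathbf X_2\times\dots$ is the product space with $\nu\langle u_1,\dots,u_k\rangle=\nu_1(u_1)\times\dots\times\nu_k(u_k)\times X_{k+1}\times X_{k+2}\times\dots$ for $k\ge1$ and $u_i\in\mathrm{dom}(\nu_i)$. Then the following hold, uniformly in all effective topological spaces $\mathbf X_i$ and all compact sets $K_i\subseteq X_i$. 1. There is a computable function that maps $\langle q_1,q_2\rangle$ to a $\tilde\kappa^\Delta$-name of $(\mathbf X_1\times\mathbf X_2,K_1\times K_2)$ whenever each $q_i$ is a $\tilde\kappa^\Delta$-name of $(\mathbf X_i,K_i)$. 2. There is a computable function that, for all $n\ge1$, maps $1^n0\langle q_1,\dots,q_n\rangle$ to a $\tilde\kappa^\Delta$-name of $(\mathbf X_1\times\dots\times\mathbf X_n,K_1\times\dots\times K_n)$ whenever each $q_i$ is a $\tilde\kappa^\Delta$-name of $(\mathbf X_i,K_i)$. 3. There is a computable function that maps $\langle q_1,q_2,\dots\rangle$ to a $\tilde\kappa^\Delta$-name of $(\mathbf X_1\times\mathbf X_2\times\dots,K_1\times K_2\times\dots)$ whenever each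 $q_i$ is a $\tilde\kappa^\Delta$-name of $(\mathbf X_i,K_i)$ and all the sets $K_i$ are non-empty. -/

import Mathlib

universe u v

namespace TTE

open Set TopologicalSpace

/-! ## Words, sequences and tupling

`A` is a finite alphabet with two distinct symbols `0` and `1`; words are `List A` and infinite
sequences are `ℕ → A`. -/

section Words

variable {A : Type} [Zero A] [One A]

/-- The wrapping function `ι(a₁ a₂ … aₖ) = 1 1 0 a₁ 0 a₂ 0 … aₖ 0 1 1`. -/
def iota (w : List A) : List A :=
  [1, 1, 0] ++ w.flatMap (fun a => [a, 0]) ++ [1, 1]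

/-- The tuple of words `⟨u₁, …, uₙ⟩ = ι(u₁) … ι(uₙ)`. -/
def wordTuple (us : List (List A)) : List A :=
  us.flatMap iota

/-- `v ≪ w` for a finite word `w`: `ι(v)` is a subword of `w`. -/
def OccursW (v w : List A) : Prop :=
  iota v <:+: w

/-- `v ≪ p` for an infinite sequence `p`: `ι(v)` is a subword of `p`. -/
def Occurs (v : List A) (p : ℕ → A) : Prop :=
  ∃ k : ℕ, ∀ (i : ℕ) (h : i < (iota v).length), (iota v)[i] = p (k + i)

/-- For a partial function `μ` from words to `Y`, the notation `μ^fs` of finite subsets: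
`μ^fs(w) = W` iff all `v ≪ w` are in `dom μ` and `W = {μ(v) | v ≪ w}`. -/
def fs {Y : Type*} (μ : List A →. Y) : List A →. Set Y := fun w =>
  ⟨∀ v, OccursW v w → (μ v).Dom, fun _ => {y | ∃ v, OccursW v w ∧ y ∈ μ v}⟩

end Words

/-- The `i`-th component `pᵢ` of a sequence `⟨p₀, …, pₙ₋₁⟩ = p₀(0) … pₙ₋₁(0) p₀(1) … pₙ₋₁(1) …`. -/
def comp {A : Type} (n i : ℕ) (q : ℕ → A) : ℕ → A := fun j => q (n * j + i)

/-- The Cantor pairing function. -/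
def cantorPair (i j : ℕ) : ℕ := (i + j) * (i + j + 1) / 2 + j

/-- The `i`-th component `pᵢ` of the sequence `⟨p₀, p₁, …⟩` that is given by
`⟨p₀, p₁, …⟩ ⟨i, j⟩ = pᵢ(j)`. -/
def compInf {A : Type} (i : ℕ) (q : ℕ → A) : ℕ → A := fun j => q (cantorPair i j)

/-! ## Type-2 Turing machines -/

/-- What a machine does in one step: the next state, the move of the head on the input tape
(`none`: no move), for every work tape the symbol written and the move of its head, and possibly
a symbol that is written on the one-way output tape. -/
structure Action (A State Idx Γ : Type) where
  next : State
  inputMove : Option Turing.Dir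
  write : Idx → Γ
  move : Idx → Option Turing.Dir
  out : Option A

/-- A Type-2 Turing machine from infinite sequences to infinite sequences over `A`: a finite
control, a read-only input tape, finitely many two-way infinite work tapes with a finite work
alphabet (its default element is the blank), and a one-way output tape. -/
structure Machine (A : Type) where
  State : Type
  [finState : Finite State]
  Idx : Type
  [finIdx : Finite Idx]
  Γ : Type
  [finΓ : Finite Γ]
  [blank : Inhabited Γ]
  start : State
  /-- The action, given the state, the scanned input symbol and the scanned work symbols. -/
  δ : State → A → (Idx → Γ) → Action A State Idx Γ

attribute [instance] Machine.finState Machine.finIdx Machine.finΓ Machine.blank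

namespace Machine

variable {A : Type} (M : Machine A)

structure Cfg where
  state : M.State
  inputPos : ℕ
  tapes : M.Idx → Turing.Tape M.Γ
  output : List A

/-- The initial configuration: blank work tapes, nothing written on the output tape. -/
def init : M.Cfg := ⟨M.start, 0, fun _ => default, []⟩

/-- The move of the input head; it stays on the first cell if told to move left from there. -/
def movePos : Option Turing.Dir → ℕ → ℕ
  | none, n => n
  | some Turing.Dir.left, n => n - 1
  | some Turing.Dir.right, n => n + 1

def moveTape {Γ : Type} [Inhabited Γ] : Option Turing.Dir → Turing.Tape Γ → Turing.Tape Γ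
  | none, T => T
  | some d, T => T.move d

/-- One step on the input sequence `p`. -/
def step (p : ℕ → A) (c : M.Cfg) : M.Cfg :=
  let a := M.δ c.state (p c.inputPos) (fun i => (c.tapes i).head)
  { state := a.next
    inputPos := movePos a.inputMove c.inputPos
    tapes := fun i => moveTape (a.move i) ((c.tapes i).write (a.write i))
    output := c.output ++ a.out.toList }

/-- The configuration after `t` steps on the input `p`. -/
def run (p : ℕ → A) (t : ℕ) : M.Cfg := (M.step p)^[t] M.init

/-- On input `p`, the machine writes (working forever) the infinite sequence `q`. -/
def Computes (p q : ℕ → A) : Prop :=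
  ∀ n : ℕ, ∃ t : ℕ, (M.run p t).output[n]? = some (q n)

end Machine

/-- A partial function on infinite sequences is computable if it is the function `f_M` of some
Type-2 Turing machine `M`. -/
def IsComputable {A : Type} (g : (ℕ → A) →. (ℕ → A)) : Prop :=
  ∃ M : Machine A, ∀ p q, q ∈ g p ↔ M.Computes p q

/-! ## Multi-representations -/

/-- A naming relation by infinite sequences: `γ p` is the set of the objects with name `p`. -/
abbrev MultiRep (A : Type) (M : Type v) := (ℕ → A) → Set M

/-- `g` realizes the partial function `f` with respect to `γ`, `γ'`. -/
def Realizes {A : Type} {M : Type u} {M' : Type v} (g : (ℕ → A) →. (ℕ → A))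
    (γ : MultiRep A M) (γ' : MultiRep A M') (f : M →. M') : Prop :=
  ∀ (p : ℕ → A) (x : M), x ∈ γ p → ∀ y ∈ f x, ∃ q ∈ g p, y ∈ γ' q

/-- The partial function `f` is `(γ, γ')`-computable. -/
def ComputableWrt {A : Type} {M : Type u} {M' : Type v}
    (γ : MultiRep A M) (γ' : MultiRep A M') (f : M →. M') : Prop :=
  ∃ g : (ℕ → A) →. (ℕ → A), IsComputable g ∧ Realizes g γ γ' f

namespace MultiRep

variable {A : Type} {M : Type u} {M' : Type v}

/-- `[γ, γ']⟨p₁, p₂⟩ = γ(p₁) × γ'(p₂)`. -/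
def pair (γ : MultiRep A M) (γ' : MultiRep A M') : MultiRep A (M × M') := fun q =>
  {x | x.1 ∈ γ (comp 2 0 q) ∧ x.2 ∈ γ' (comp 2 1 q)}

/-- `[γ]⁺(1ⁿ 0 ⟨p₁, …, pₙ⟩) = {n} × γ(p₁) × … × γ(pₙ)` for `n ≥ 1`, a multi-representation of the
disjoint union of the finite powers `Mⁿ`, `n ≥ 1`; the element `⟨m, x⟩` of the sigma type is an
`n`-tuple for `n = m + 1`. -/
def plus [Zero A] [One A] (γ : MultiRep A M) : MultiRep A (Σ m : ℕ, Fin (m + 1) → M) := fun q =>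
  {x | (∀ i < x.1 + 1, q i = 1) ∧ q (x.1 + 1) = 0 ∧
    ∀ i : Fin (x.1 + 1), x.2 i ∈ γ (comp (x.1 + 1) i fun j => q (x.1 + 2 + j))}

/-- `(x₀, x₁, …) ∈ [γ]^ℕ ⟨p₀, p₁, …⟩` iff `xᵢ ∈ γ(pᵢ)` for all `i`. -/
def seq (γ : MultiRep A M) : MultiRep A (ℕ → M) := fun q =>
  {x | ∀ i, x i ∈ γ (compInf i q)}

end MultiRep

/-! ## Effective topological spaces -/

/-- An effective topological space `(X, τ, β, ν)`: a `T₀`-space with a partial function `ν` from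
words onto a base `β` of its topology (so `β` is the range of `ν`). -/
structure EffSpace (A : Type) : Type (u + 1) where
  carrier : Type u
  [top : TopologicalSpace carrier]
  [t0 : T0Space carrier]
  ν : List A →. Set carrier
  isBase : IsTopologicalBasis ν.ran

attribute [instance] EffSpace.top EffSpace.t0

section Spaces

variable {A : Type} [Zero A] [One A]

/-- The multi-representation `Δ` of the class of effective topological spaces:
`X ∈ Δ⟨r, s⟩` iff `r` enumerates the graph of the characteristic function of `dom ν` and `s`
enumerates a set `S ⊆ (dom ν)³` with `ν(u) ∩ ν(v) = ⋃ {ν(w) | (u, v, w) ∈ S}` for all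
`u, v ∈ dom ν`. -/
def Delta : MultiRep A (EffSpace.{u} A) := fun t =>
  {X | (∀ z, Occurs z (comp 2 0 t) ↔
          ∃ w, (w ∈ X.ν.Dom ∧ z = wordTuple [w, [1]]) ∨ (w ∉ X.ν.Dom ∧ z = wordTuple [w, [0]])) ∧
    ∃ S : Set (List A × List A × List A),
      (∀ u v w, (u, v, w) ∈ S → u ∈ X.ν.Dom ∧ v ∈ X.ν.Dom ∧ w ∈ X.ν.Dom) ∧
      (∀ z, Occurs z (comp 2 1 t) ↔ ∃ u v w, (u, v, w) ∈ S ∧ z = wordTuple [u, v, w]) ∧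
      ∀ u v, ∀ U ∈ X.ν u, ∀ V ∈ X.ν v, U ∩ V = ⋃₀ {W | ∃ w, (u, v, w) ∈ S ∧ W ∈ X.ν w}}

/-- The minimal-cover relation of a space `X`: `p` lists exactly the (names `w` of) finite sets of
base elements that cover `K` and all of whose elements meet `K`. -/
def kappaTilde (X : EffSpace.{u} A) : MultiRep A (Set X.carrier) := fun p =>
  {K | ∀ w, Occurs w p ↔
    (∃ W ∈ fs X.ν w, K ⊆ ⋃₀ W) ∧ ∀ v, OccursW v w → ∃ U ∈ X.ν v, (U ∩ K).Nonempty}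

end Spaces

/-- The class of pairs `(X, K)` of an effective topological space and a compact subset. -/
structure CompactPair (A : Type) : Type (u + 1) where
  space : EffSpace.{u} A
  set : Set space.carrier
  isCompact : IsCompact set

/-- `(X, K) ∈ κ̃^Δ⟨r, s⟩` iff `X ∈ Δ(r)` and `K ∈ κ̃_X(s)`. -/
def kappaTildeDelta {A : Type} [Zero A] [One A] : MultiRep A (CompactPair.{u} A) := fun q =>
  {C | C.space ∈ Delta (comp 2 0 q) ∧ C.set ∈ kappaTilde C.space (comp 2 1 q)}

/-! ## Products -/

section Products

variable {A : Type} [Zero A] [One A] [NeZero (1 : A)]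

theorem iota_append_inj {u v s t : List A} (h : iota u ++ s = iota v ++ t) : u = v ∧ s = t := by
  have h1 : (1 : A) ≠ 0 := NeZero.ne 1
  simp only [iota, List.append_assoc, List.append_cancel_left_eq] at h
  induction u generalizing v with
  | nil =>
    cases v with
    | nil => simpa using h
    | cons b v => simp [h1] at h
  | cons a u ih =>
    cases v with
    | nil => simp [h1.symm] at h
    | cons b v =>
      simp only [List.flatMap_cons, List.cons_append, List.nil_append, List.cons.injEq,
        true_and] at h
      obtain ⟨rfl, h⟩ := h
      obtain ⟨rfl, rfl⟩ := ih h
      exact ⟨rfl, rfl⟩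

theorem wordTuple_injective : Function.Injective (wordTuple (A := A)) := by
  intro us
  induction us with
  | nil =>
    intro vs h
    cases vs with
    | nil => rfl
    | cons v vs => simp [wordTuple, iota] at h
  | cons u us ih =>
    intro vs h
    cases vs with
    | nil => simp [wordTuple, iota] at h
    | cons v vs =>
      simp only [wordTuple, List.flatMap_cons] at h
      obtain ⟨rfl, h'⟩ := iota_append_inj h
      rw [ih h']

/-- The notation of the base of `X₁ × X₂`: `ν⟨u₁, u₂⟩ = ν₁(u₁) × ν₂(u₂)` for `uᵢ ∈ dom νᵢ`. -/
def prodNu (X Y : EffSpace.{u} A) : List A →. Set (X.carrier × Y.carrier) := fun w =>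
  ⟨∃ u₁ u₂, w = wordTuple [u₁, u₂] ∧ u₁ ∈ X.ν.Dom ∧ u₂ ∈ Y.ν.Dom,
    fun _ => {x | ∃ u₁ u₂, w = wordTuple [u₁, u₂] ∧
      (∃ U ∈ X.ν u₁, x.1 ∈ U) ∧ ∃ V ∈ Y.ν u₂, x.2 ∈ V}⟩

theorem mem_prodNu {X Y : EffSpace.{u} A} {w : List A} {S : Set (X.carrier × Y.carrier)} :
    S ∈ prodNu X Y w ↔
      ∃ u₁ u₂, w = wordTuple [u₁, u₂] ∧ ∃ U ∈ X.ν u₁, ∃ V ∈ Y.ν u₂, S = U ×ˢ V := by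
  have key : ∀ u₁ u₂ U V, U ∈ X.ν u₁ → V ∈ Y.ν u₂ →
      {x : X.carrier × Y.carrier | ∃ v₁ v₂, wordTuple [u₁, u₂] = wordTuple [v₁, v₂] ∧
        (∃ U ∈ X.ν v₁, x.1 ∈ U) ∧ ∃ V ∈ Y.ν v₂, x.2 ∈ V} = U ×ˢ V := by
    intro u₁ u₂ U V hU hV
    ext x
    constructor
    · rintro ⟨v₁, v₂, h, ⟨U', hU', hx⟩, V', hV', hy⟩
      have h' := wordTuple_injective h
      simp only [List.cons.injEq, and_true] at h'
      obtain ⟨rfl, rfl⟩ := h'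
      rw [Part.mem_unique hU hU', Part.mem_unique hV hV']
      exact ⟨hx, hy⟩
    · rintro ⟨hx, hy⟩
      exact ⟨u₁, u₂, rfl, ⟨U, hU, hx⟩, V, hV, hy⟩
  constructor
  · rintro ⟨⟨u₁, u₂, rfl, h1, h2⟩, rfl⟩
    exact ⟨u₁, u₂, rfl, _, Part.get_mem h1, _, Part.get_mem h2,
      key _ _ _ _ (Part.get_mem h1) (Part.get_mem h2)⟩
  · rintro ⟨u₁, u₂, rfl, U, hU, V, hV, rfl⟩
    exact ⟨⟨u₁, u₂, rfl, Part.dom_iff_mem.2 ⟨_, hU⟩, Part.dom_iff_mem.2 ⟨_, hV⟩⟩,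
      key _ _ _ _ hU hV⟩

/-- The product `X₁ × X₂`. The topology generated by the base is the product topology. -/
def EffSpace.prod (X Y : EffSpace.{u} A) : EffSpace.{u} A where
  carrier := X.carrier × Y.carrier
  ν := prodNu X Y
  isBase := by
    have h : (prodNu X Y).ran = Set.image2 (· ×ˢ ·) X.ν.ran Y.ν.ran := by
      ext S
      constructor
      · rintro ⟨w, hw⟩
        obtain ⟨u₁, u₂, -, U, hU, V, hV, rfl⟩ := mem_prodNu.1 hw
        exact ⟨U, ⟨u₁, hU⟩, V, ⟨u₂, hV⟩, rfl⟩
      · rintro ⟨U, ⟨u₁, hU⟩, V, ⟨u₂, hV⟩, rfl⟩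
        exact ⟨_, mem_prodNu.2 ⟨u₁, u₂, rfl, U, hU, V, hV, rfl⟩⟩
    rw [h]
    exact X.isBase.prod Y.isBase

/-- The notation of the base of `X₀ × X₁ × …`:
`ν⟨u₀, …, uₖ₋₁⟩ = ν₀(u₀) × … × νₖ₋₁(uₖ₋₁) × Xₖ × Xₖ₊₁ × …` for `k ≥ 1` and `uᵢ ∈ dom νᵢ`. -/
def piNu (X : ℕ → EffSpace.{u} A) : List A →. Set (∀ i, (X i).carrier) := fun w =>
  ⟨∃ us : List (List A), us ≠ [] ∧ w = wordTuple us ∧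
      ∀ (i : ℕ) (h : i < us.length), us[i] ∈ (X i).ν.Dom,
    fun _ => {x | ∃ us : List (List A), us ≠ [] ∧ w = wordTuple us ∧
      ∀ (i : ℕ) (h : i < us.length), ∃ U ∈ (X i).ν us[i], x i ∈ U}⟩

theorem mem_piNu {X : ℕ → EffSpace.{u} A} {w : List A} {S : Set (∀ i, (X i).carrier)} :
    S ∈ piNu X w ↔
      ∃ us : List (List A), us ≠ [] ∧ w = wordTuple us ∧
        ∃ U : ∀ i, Set (X i).carrier, (∀ (i : ℕ) (h : i < us.length), U i ∈ (X i).ν us[i]) ∧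
          S = {x | ∀ i < us.length, x i ∈ U i} := by
  have key : ∀ (us : List (List A)) (U : ∀ i, Set (X i).carrier), us ≠ [] →
      (∀ (i : ℕ) (h : i < us.length), U i ∈ (X i).ν us[i]) →
      {x : ∀ i, (X i).carrier | ∃ vs : List (List A), vs ≠ [] ∧ wordTuple us = wordTuple vs ∧
        ∀ (i : ℕ) (h : i < vs.length), ∃ U ∈ (X i).ν vs[i], x i ∈ U} =
      {x | ∀ i < us.length, x i ∈ U i} := by
    intro us U hne hU
    ext x
    constructor
    · rintro ⟨vs, -, h, hx⟩ i hi
      obtain rfl := wordTuple_injective h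
      obtain ⟨U', hU', hxU⟩ := hx i hi
      rwa [Part.mem_unique (hU i hi) hU']
    · intro hx
      exact ⟨us, hne, rfl, fun i hi => ⟨U i, hU i hi, hx i hi⟩⟩
  constructor
  · rintro ⟨⟨us, hne, rfl, hd⟩, rfl⟩
    have hU : ∀ (i : ℕ) (h : i < us.length),
        (if h : i < us.length then ((X i).ν us[i]).get (hd i h) else ∅) ∈ (X i).ν us[i] := by
      intro i h
      rw [dif_pos h]
      exact Part.get_mem _
    exact ⟨us, hne, rfl, _, hU, key us _ hne hU⟩
  · rintro ⟨us, hne, rfl, U, hU, rfl⟩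
    exact ⟨⟨us, hne, rfl, fun i h => Part.dom_iff_mem.2 ⟨_, hU i h⟩⟩, key us U hne hU⟩

/-- The countable product `X₀ × X₁ × …`. The topology generated by the base is the product
topology. -/
def EffSpace.pi (X : ℕ → EffSpace.{u} A) : EffSpace.{u} A where
  carrier := ∀ i, (X i).carrier
  ν := piNu X
  isBase := by
    refine isTopologicalBasis_of_isOpen_of_nhds ?_ ?_
    · rintro S ⟨w, hw⟩
      obtain ⟨us, -, -, U, hU, rfl⟩ := mem_piNu.1 hw
      have : {x : ∀ i, (X i).carrier | ∀ i < us.length, x i ∈ U i} =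
          ⋂ i ∈ Set.Iio us.length, (fun x : ∀ i, (X i).carrier => x i) ⁻¹' U i := by
        ext x
        simp
      rw [this]
      exact (Set.finite_Iio _).isOpen_biInter fun i hi =>
        ((X i).isBase.isOpen ⟨_, hU i hi⟩).preimage (continuous_apply i)
    · intro x O hx hO
      obtain ⟨F, V, hV, hVO⟩ := isOpen_pi_iff.1 hO x hx
      classical
      have hex : ∀ i, ∃ (u : List A) (U : Set (X i).carrier), U ∈ (X i).ν u ∧ x i ∈ U ∧
          (i ∈ F → U ⊆ V i) := by
        intro i
        have hopen : IsOpen (if i ∈ F then V i else Set.univ) := by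
          split_ifs with hi
          · exact (hV i hi).1
          · exact isOpen_univ
        have hmem : x i ∈ (if i ∈ F then V i else Set.univ) := by
          split_ifs with hi
          · exact (hV i hi).2
          · trivial
        obtain ⟨U, ⟨u, hu⟩, hxU, hUV⟩ := (X i).isBase.exists_subset_of_mem_open hmem hopen
        exact ⟨u, U, hu, hxU, fun hi => by simpa [hi] using hUV⟩
      choose u U hU hxU hUV using hex
      let k := F.sup id + 1
      refine ⟨{y | ∀ i < k, y i ∈ U i}, ⟨wordTuple (List.ofFn fun i : Fin k => u i), ?_⟩,
        fun i _ => hxU i, ?_⟩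
      · refine mem_piNu.2 ⟨List.ofFn fun i : Fin k => u i, ?_, rfl, U, ?_, ?_⟩
        · simp [k]
        · intro i h
          rw [List.getElem_ofFn]
          exact hU i
        · rw [List.length_ofFn]
      · intro y hy
        exact hVO fun i hi => hUV i hi (hy i (Nat.lt_succ_of_le (Finset.le_sup (f := id) hi)))

namespace CompactPair

/-- `((X₁, K₁), (X₂, K₂)) ↦ (X₁ × X₂, K₁ × K₂)`. -/
def prod (C : CompactPair.{u} A × CompactPair.{u} A) : CompactPair.{u} A where
  space := C.1.space.prod C.2.space
  set := C.1.set ×ˢ C.2.set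
  isCompact := C.1.isCompact.prod C.2.isCompact

/-- The finite product `((X₁, K₁), …, (Xₙ, Kₙ)) ↦ (X₁ × … × Xₙ, K₁ × … × Kₙ)` for `n = m + 1`,
where `X₁ × … × Xₙ₊₁ := (X₁ × … × Xₙ) × Xₙ₊₁` by induction, and the one-fold product is `X₁`. -/
def finProdAux : (m : ℕ) → (Fin (m + 1) → CompactPair.{u} A) → CompactPair.{u} A
  | 0, C => C 0
  | m + 1, C => prod (finProdAux m fun i => C i.castSucc, C (Fin.last (m + 1)))

/-- The finite products, uniformly in the number of factors. -/
def finProd (C : Σ m : ℕ, Fin (m + 1) → CompactPair.{u} A) : CompactPair.{u} A :=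
  finProdAux C.1 C.2

/-- `((X₀, K₀), (X₁, K₁), …) ↦ (X₀ × X₁ × …, K₀ × K₁ × …)`. -/
def pi (C : ℕ → CompactPair.{u} A) : CompactPair.{u} A where
  space := EffSpace.pi fun i => (C i).space
  set := Set.univ.pi fun i => (C i).set
  isCompact := isCompact_univ_pi fun i => (C i).isCompact

/-- The countable product, as a partial function on the sequences with non-empty `Kᵢ`. -/
def piNonempty : (ℕ → CompactPair.{u} A) →. CompactPair.{u} A := fun C =>
  ⟨∀ i, (C i).set.Nonempty, fun _ => pi C⟩

end CompactPair

end Products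

end TTE

/-!
A finite prefix of the input shows finitely many words that are listed by the names of the factors.
A word codes a base element of the product iff its components code base elements of the factors,
such a base element meets the product of the compact sets iff every component does, and the
intersection of two base elements is described componentwise, where coordinates that occur in only
one of the two tuples keep their component. Hence each of these properties is verified by a finite
prefix of the input.

By distributivity, a finite union of boxes `⋂ i, U k i` contains the product of the compact sets
iff, for every choice of a side `U k (i k)` of each box, every point of the product lies on a chosen
side. A point that violates this can be assembled coordinate by coordinate, so the condition says
that for a single `i` the chosen sides in the coordinate `i` cover `K i`. This is visible in a
finite prefix of the name of `K i`, also if there are infinitely many factors.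

A map on finite words that is computable and sends longer prefixes of the input to longer prefixes
of the output is realized by a Type-2 machine, whose work tapes simulate the stacks of a stack
machine for the map.
-/

namespace TTE

/-! ## Simulating stack programs by Type-2 machines -/

section StackPrograms

open Turing

/-- The tape `T` holds the stack `l`: the head scans the top of the stack, and the stack extends
to the left. What is to the right of the head is irrelevant. -/
def StackTape {B : Type} (T : Tape (Option B)) (l : List B) : Prop :=
  T.left.cons T.head = ListBlank.mk (l.map some)

namespace StackTape

variable {B : Type} {T : Tape (Option B)} {l : List B}

theorem head_eq (h : StackTape T l) : T.head = l.head? := by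
  have h' := congrArg ListBlank.head h
  rw [ListBlank.head_cons, ListBlank.head_mk] at h'
  cases l <;> exact h'

theorem pop (h : StackTape T l) : StackTape ((T.write none).move Dir.left) l.tail := by
  have h' := congrArg ListBlank.tail h
  rw [ListBlank.tail_cons, ListBlank.tail_mk] at h'
  simp only [StackTape, Tape.move, Tape.write, ListBlank.cons_head_tail, h', List.map_tail]

theorem push (h : StackTape T l) (b : B) :
    StackTape ((T.move Dir.right).write (some b)) (b :: l) := by
  have h' : T.left.cons T.head = ListBlank.mk (l.map some) := h
  simp only [StackTape, Tape.move, Tape.write, h', List.map_cons, ListBlank.cons_mk]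

theorem write_head (h : StackTape T l) : StackTape (T.write l.head?) l := by
  rwa [← h.head_eq, Tape.write_self]

theorem default_nil : StackTape (default : Tape (Option B)) [] :=
  ListBlank.cons_head_tail (ListBlank.mk ([] : List (Option B)))

end StackTape

/-- A stack program in the sense of `Turing.TM2`, over finitely many stacks with one common
alphabet `B`, that is run once for every input symbol `a`: at first the statement `first a` is
executed and later `next a`. When the program halts, the run of symbols `digit` on top of the stack
`main` is removed, and its length `j ≤ bound` selects the output `emit j`. -/
structure StackTransducer (A K B Λ σ : Type) where
  tr : Λ → TM2.Stmt (fun _ : K => B) Λ σ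
  support : Finset Λ
  first : A → TM2.Stmt (fun _ : K => B) Λ σ
  next : A → TM2.Stmt (fun _ : K => B) Λ σ
  var : σ
  main : K
  digit : B
  bound : ℕ
  emit : ℕ → Option A
  supports_tr : ∀ l ∈ support, TM2.SupportsStmt support (tr l)
  supports_first : ∀ a, TM2.SupportsStmt support (first a)
  supports_next : ∀ a, TM2.SupportsStmt support (next a)

namespace StackTransducer

/-- The control states of the machine for a stack program: before the first symbol and before any
other symbol is read, inside the program, inside a `push` (which takes two steps, since a machine
writes before it moves), and after having popped `j` digits. -/
inductive Control (K B Λ σ : Type)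
  | start
  | readNext
  | run (q : TM2.Stmt (fun _ : K => B) Λ σ) (v : σ)
  | write (k : K) (b : B) (q : TM2.Stmt (fun _ : K => B) Λ σ) (v : σ)
  | popDigits (j : ℕ)

open Control

variable {A K B Λ σ : Type} (T : StackTransducer A K B Λ σ)

section Machine

/-- The statements that can occur in a run. -/
def stmts : Set (TM2.Stmt (fun _ : K => B) Λ σ) :=
  {q | ∃ r ∈ T.tr '' T.support ∪ Set.range T.first ∪ Set.range T.next, q ∈ TM2.stmts₁ r}

variable {T}

theorem first_mem_stmts (a : A) : T.first a ∈ T.stmts :=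
  ⟨_, Or.inl (Or.inr ⟨a, rfl⟩), TM2.stmts₁_self⟩

theorem next_mem_stmts (a : A) : T.next a ∈ T.stmts :=
  ⟨_, Or.inr ⟨a, rfl⟩, TM2.stmts₁_self⟩

theorem mem_stmts_of_mem_stmts₁ {q q' : TM2.Stmt (fun _ : K => B) Λ σ} (hq : q ∈ T.stmts)
    (h : q' ∈ TM2.stmts₁ q) : q' ∈ T.stmts :=
  let ⟨r, hr, hqr⟩ := hq
  ⟨r, hr, TM2.stmts₁_trans hqr h⟩

theorem supportsStmt_of_mem_stmts {q : TM2.Stmt (fun _ : K => B) Λ σ} (hq : q ∈ T.stmts) :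
    TM2.SupportsStmt T.support q := by
  obtain ⟨r, (⟨l, hl, rfl⟩ | ⟨a, rfl⟩) | ⟨a, rfl⟩, hqr⟩ := hq
  · exact TM2.stmts₁_supportsStmt_mono hqr (T.supports_tr l hl)
  · exact TM2.stmts₁_supportsStmt_mono hqr (T.supports_first a)
  · exact TM2.stmts₁_supportsStmt_mono hqr (T.supports_next a)

theorem tr_mem_stmts {f : σ → Λ} (h : TM2.Stmt.goto f ∈ T.stmts) (v : σ) :
    T.tr (f v) ∈ T.stmts :=
  ⟨_, Or.inl (Or.inl ⟨_, supportsStmt_of_mem_stmts h v, rfl⟩), TM2.stmts₁_self⟩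

theorem finite_stmts [Finite A] : T.stmts.Finite := by
  have hfin := ((T.support.finite_toSet.image T.tr).union (Set.finite_range T.first)).union
    (Set.finite_range T.next)
  refine (hfin.biUnion fun r _ => (TM2.stmts₁ r).finite_toSet).subset fun q hq => ?_
  obtain ⟨r, hr, hqr⟩ := hq
  exact Set.mem_biUnion hr hqr

variable (T)

/-- The control states that can occur in a run. -/
def Valid : Control K B Λ σ → Prop
  | start => True
  | readNext => True
  | run q _ => q ∈ T.stmts
  | write _ _ q _ => q ∈ T.stmts
  | popDigits j => j ≤ T.bound

theorem finite_valid [Finite A] [Finite K] [Finite B] [Finite σ] : Finite {s // T.Valid s} := by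
  have hq := finite_stmts (T := T)
  have hrun := (hq.prod Set.finite_univ).image fun x : _ × σ => run x.1 x.2
  have hwrite := (((Set.finite_univ (α := K)).prod (Set.finite_univ (α := B))).prod
    (hq.prod (Set.finite_univ (α := σ)))).image fun x => write x.1.1 x.1.2 x.2.1 x.2.2
  have hpop := (Set.finite_Iic T.bound).image (popDigits : ℕ → Control K B Λ σ)
  refine (((Set.toFinite {start, readNext}).union hrun).union (hwrite.union hpop)).subset ?_
  rintro (_ | _ | ⟨q, v⟩ | ⟨k, b, q, v⟩ | j) hs
  · simp
  · simp
  · exact Or.inl (Or.inr ⟨(q, v), ⟨hs, trivial⟩, rfl⟩)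
  · exact Or.inr (Or.inl ⟨((k, b), q, v), ⟨⟨trivial, trivial⟩, hs, trivial⟩, rfl⟩)
  · exact Or.inr (Or.inr ⟨j, hs, rfl⟩)

variable [DecidableEq K] [DecidableEq B]

/-- The transition function. The second argument is the scanned input symbol, the third one
consists of the top symbols of the stacks. -/
def act : Control K B Λ σ → A → (K → Option B) → Action A (Control K B Λ σ) K (Option B)
  | start, a, h => ⟨run (T.first a) T.var, none, h, fun _ => none, none⟩
  | readNext, a, h => ⟨run (T.next a) T.var, none, h, fun _ => none, none⟩
  | run (TM2.Stmt.push k f q) v, _, h =>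
    ⟨write k (f v) q v, none, h, Function.update (fun _ => none) k (some Dir.right), none⟩
  | run (TM2.Stmt.peek k f q) v, _, h => ⟨run q (f v (h k)), none, h, fun _ => none, none⟩
  | run (TM2.Stmt.pop k f q) v, _, h =>
    ⟨run q (f v (h k)), none, Function.update h k none,
      Function.update (fun _ => none) k (some Dir.left), none⟩
  | run (TM2.Stmt.load f q) v, _, h => ⟨run q (f v), none, h, fun _ => none, none⟩
  | run (TM2.Stmt.branch f q₁ q₂) v, _, h =>
    ⟨run (cond (f v) q₁ q₂) v, none, h, fun _ => none, none⟩
  | run (TM2.Stmt.goto f) v, _, h => ⟨run (T.tr (f v)) v, none, h, fun _ => none, none⟩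
  | run TM2.Stmt.halt _, _, h => ⟨popDigits 0, none, h, fun _ => none, none⟩
  | write k b q v, _, h => ⟨run q v, none, Function.update h k (some b), fun _ => none, none⟩
  | popDigits j, _, h =>
    if h T.main = some T.digit then
      ⟨popDigits (min (j + 1) T.bound), none, Function.update h T.main none,
        Function.update (fun _ => none) T.main (some Dir.left), none⟩
    else ⟨readNext, some Dir.right, h, fun _ => none, T.emit j⟩

variable {T}

theorem valid_act {s : Control K B Λ σ} (hs : T.Valid s) (a : A) (h : K → Option B) :
    T.Valid (T.act s a h).next := by
  rcases s with _ | _ | ⟨q, v⟩ | ⟨k, b, q, v⟩ | j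
  · exact first_mem_stmts a
  · exact next_mem_stmts a
  · cases q with
    | goto f => exact tr_mem_stmts hs v
    | halt => exact Nat.zero_le _
    | branch f q₁ q₂ =>
      refine mem_stmts_of_mem_stmts₁ hs ?_
      simp only [TM2.stmts₁, Finset.mem_insert, Finset.mem_union]
      cases f v
      · exact Or.inr (Or.inr TM2.stmts₁_self)
      · exact Or.inr (Or.inl TM2.stmts₁_self)
    | _ => exact mem_stmts_of_mem_stmts₁ hs (by simp [TM2.stmts₁, TM2.stmts₁_self])
  · exact hs
  · simp only [act]
    split_ifs
    · exact min_le_right _ _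
    · trivial

variable (T)

/-- The machine that runs the stack program on the successive input symbols. -/
abbrev machine [Finite A] [Finite K] [Finite B] [Finite σ] : Machine A :=
  haveI := T.finite_valid
  { State := {s // T.Valid s}
    Idx := K
    Γ := Option B
    start := ⟨start, trivial⟩
    δ := fun s a h =>
      { next := ⟨(T.act s.1 a h).next, valid_act s.2 a h⟩
        inputMove := (T.act s.1 a h).inputMove
        write := (T.act s.1 a h).write
        move := (T.act s.1 a h).move
        out := (T.act s.1 a h).out } }

end Machine

section Simulation

variable [DecidableEq K] [DecidableEq B] [Finite A] [Finite K] [Finite B] [Finite σ]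

/-- An abstract configuration of the machine, with stacks instead of tapes. -/
structure StackCfg (A K B Λ σ : Type) where
  state : Control K B Λ σ
  inputPos : ℕ
  stk : K → List B
  output : List A

/-- The configuration `C` of the machine implements the abstract configuration `x`. -/
structure Implements (C : T.machine.Cfg) (x : StackCfg A K B Λ σ) : Prop where
  state_eq : C.state.1 = x.state
  inputPos_eq : C.inputPos = x.inputPos
  stackTape : ∀ k, StackTape (C.tapes k) (x.stk k)
  output_eq : C.output = x.output

/-- On input `p`, the machine gets from `x` to `y`. -/
def Leads (p : ℕ → A) (x y : StackCfg A K B Λ σ) : Prop :=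
  ∀ C, T.Implements C x → ∃ t, T.Implements ((T.machine.step p)^[t] C) y

variable {T} {p : ℕ → A} {n : ℕ} {S : K → List B} {o : List A}

theorem Leads.refl (x : StackCfg A K B Λ σ) : T.Leads p x x := fun _ h => ⟨0, h⟩

theorem Leads.trans {x y z : StackCfg A K B Λ σ} (hxy : T.Leads p x y) (hyz : T.Leads p y z) :
    T.Leads p x z := by
  intro C hC
  obtain ⟨t, ht⟩ := hxy C hC
  obtain ⟨t', ht'⟩ := hyz _ ht
  exact ⟨t' + t, by rwa [Function.iterate_add_apply]⟩

theorem step_of_act_eq {C : T.machine.Cfg} {s : Control K B Λ σ}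
    {a : Action A (Control K B Λ σ) K (Option B)} (hs : C.state.1 = s)
    (ha : T.act s (p C.inputPos) (fun k => (C.tapes k).head) = a) :
    (T.machine.step p C).state.1 = a.next ∧
      (T.machine.step p C).inputPos = Machine.movePos a.inputMove C.inputPos ∧
      (∀ k, (T.machine.step p C).tapes k =
        Machine.moveTape (a.move k) ((C.tapes k).write (a.write k))) ∧
      (T.machine.step p C).output = C.output ++ a.out.toList := by
  subst hs ha
  exact ⟨rfl, rfl, fun _ => rfl, rfl⟩

theorem leads_of_act {s : Control K B Λ σ}
    {a : Action A (Control K B Λ σ) K (Option B)} {S' : K → List B}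
    (ha : T.act s (p n) (fun k => (S k).head?) = a)
    (hS' : ∀ (k : K) (U : Tape (Option B)), StackTape U (S k) →
      StackTape (Machine.moveTape (a.move k) (U.write (a.write k))) (S' k)) :
    T.Leads p ⟨s, n, S, o⟩
      ⟨a.next, Machine.movePos a.inputMove n, S', o ++ a.out.toList⟩ := by
  rintro C ⟨hs, rfl, hS, rfl⟩
  simp only at hs hS ha
  have heads : (fun k => (C.tapes k).head) = fun k => (S k).head? :=
    funext fun k => (hS k).head_eq
  obtain ⟨hstate, hpos, htapes, hout⟩ :=
    step_of_act_eq hs ((congrArg (T.act s (p C.inputPos)) heads).trans ha)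
  exact ⟨1, hstate, hpos, fun k => (htapes k).symm ▸ hS' k _ (hS k), hout⟩

theorem leads_of_act_eq_keep {s s' : Control K B Λ σ} {i : Option Dir} {x : Option A}
    (h : T.act s (p n) (fun k => (S k).head?) =
      ⟨s', i, fun k => (S k).head?, fun _ => none, x⟩) :
    T.Leads p ⟨s, n, S, o⟩ ⟨s', Machine.movePos i n, S, o ++ x.toList⟩ :=
  leads_of_act h fun _ _ hU => hU.write_head

theorem leads_of_act_eq_silent {s s' : Control K B Λ σ}
    (h : T.act s (p n) (fun k => (S k).head?) =
      ⟨s', none, fun k => (S k).head?, fun _ => none, none⟩) :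
    T.Leads p ⟨s, n, S, o⟩ ⟨s', n, S, o⟩ := by
  simpa [Machine.movePos] using leads_of_act_eq_keep (o := o) h

theorem leads_of_act_eq_pop {s s' : Control K B Λ σ} {k : K}
    (h : T.act s (p n) (fun k => (S k).head?) =
      ⟨s', none, Function.update (fun k => (S k).head?) k none,
        Function.update (fun _ => none) k (some Dir.left), none⟩) :
    T.Leads p ⟨s, n, S, o⟩ ⟨s', n, Function.update S k (S k).tail, o⟩ := by
  have := leads_of_act (o := o) h (S' := Function.update S k (S k).tail) fun k' U hU => by
    by_cases hk : k' = k
    · subst hk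
      simpa only [Function.update_self, Machine.moveTape] using hU.pop
    · simpa only [Function.update_of_ne hk, Machine.moveTape] using hU.write_head
  simpa [Machine.movePos] using this

theorem leads_push {k : K} {f : σ → B} {q : TM2.Stmt (fun _ : K => B) Λ σ} {v : σ} :
    T.Leads p ⟨run (TM2.Stmt.push k f q) v, n, S, o⟩
      ⟨run q v, n, Function.update S k (f v :: S k), o⟩ := by
  rintro C ⟨hs, hn, hS, ho⟩
  obtain ⟨hs₁, hn₁, htapes₁, ho₁⟩ := step_of_act_eq (p := p) (a := ⟨write k (f v) q v, none,
    fun k => (C.tapes k).head, Function.update (fun _ => none) k (some Dir.right), none⟩) hs rfl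
  obtain ⟨hs₂, hn₂, htapes₂, ho₂⟩ := step_of_act_eq (p := p) (a := ⟨run q v, none,
    Function.update (fun k => ((T.machine.step p C).tapes k).head) k (some (f v)),
    fun _ => none, none⟩) hs₁ rfl
  refine ⟨2, hs₂, hn₂.trans (hn₁.trans hn), fun (k' : K) => (htapes₂ k').symm ▸ ?_, ?_⟩
  · by_cases hk : k' = k
    · subst hk
      simpa only [Function.update_self, htapes₁, Machine.moveTape, Tape.write_self] using
        (hS k').push (f v)
    · simpa only [Function.update_of_ne hk, htapes₁, Machine.moveTape, Tape.write_self] using hS k'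
  · simpa [ho₁, ho] using ho₂

variable (T) in
/-- The control state for a label of the stack program (`none`: the program has halted). -/
def ofLabel (l : Option Λ) (v : σ) : Control K B Λ σ :=
  l.elim (popDigits 0) fun l => run (T.tr l) v

theorem leads_stepAux (q : TM2.Stmt (fun _ : K => B) Λ σ) (v : σ) :
    T.Leads p ⟨run q v, n, S, o⟩
      ⟨T.ofLabel (TM2.stepAux q v S).l (TM2.stepAux q v S).var, n, (TM2.stepAux q v S).stk, o⟩ := by
  induction q generalizing v S with
  | push k f q ih => exact leads_push.trans (ih _)
  | peek k f q ih => exact (leads_of_act_eq_silent rfl).trans (ih _)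
  | pop k f q ih => exact (leads_of_act_eq_pop rfl).trans (ih _)
  | load f q ih => exact (leads_of_act_eq_silent rfl).trans (ih _)
  | branch f q₁ q₂ ih₁ ih₂ =>
    refine (leads_of_act_eq_silent rfl).trans ?_
    simp only [TM2.stepAux]
    cases f v
    · exact ih₂ _
    · exact ih₁ _
  | goto f => exact leads_of_act_eq_silent rfl
  | halt => exact leads_of_act_eq_silent rfl

theorem leads_of_reaches {x y : TM2.Cfg (fun _ : K => B) Λ σ}
    (h : StateTransition.Reaches (TM2.step T.tr) x y) :
    T.Leads p ⟨T.ofLabel x.l x.var, n, x.stk, o⟩ ⟨T.ofLabel y.l y.var, n, y.stk, o⟩ := by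
  induction h with
  | refl => exact Leads.refl _
  | @tail y z _ h ih =>
    refine ih.trans ?_
    obtain ⟨_ | l, v, S⟩ := y
    · simp [TM2.step] at h
    · simp only [TM2.step, Option.mem_def, Option.some.injEq] at h
      subst h
      exact leads_stepAux _ _

theorem leads_popDigits {l : List B} (hl : l.head? ≠ some T.digit) {i j : ℕ}
    (hij : i + j ≤ T.bound) :
    T.Leads p
      ⟨popDigits i, n, Function.update S T.main (List.replicate j T.digit ++ l), o⟩
      ⟨readNext, n + 1, Function.update S T.main l, o ++ (T.emit (i + j)).toList⟩ := by
  induction j generalizing i with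
  | zero => exact leads_of_act_eq_keep (i := some Dir.right) (by simp [act, hl])
  | succ j ih =>
    refine (leads_of_act_eq_pop (k := T.main) (s' := popDigits (i + 1)) ?_).trans ?_
    · simp [act, List.replicate_succ, show i + 1 ≤ T.bound by lia]
    · simpa [List.replicate_succ, Nat.add_right_comm i 1 j, add_assoc] using
        ih (i := i + 1) (by lia)

variable (T) in
/-- Executing the statement `q` on the stacks `S` ends with the stacks `S'` and, above them on the
stack `main`, the unary number `j`. -/
def Transforms (q : TM2.Stmt (fun _ : K => B) Λ σ) (S S' : K → List B) (j : ℕ) : Prop :=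
  j ≤ T.bound ∧ (S' T.main).head? ≠ some T.digit ∧
    ∃ v, StateTransition.Reaches (TM2.step T.tr) (TM2.stepAux q T.var S)
      ⟨none, v, Function.update S' T.main (List.replicate j T.digit ++ S' T.main)⟩

theorem Transforms.leads {q : TM2.Stmt (fun _ : K => B) Λ σ} {S' : K → List B} {j : ℕ}
    (h : T.Transforms q S S' j) :
    T.Leads p ⟨run q T.var, n, S, o⟩ ⟨readNext, n + 1, S', o ++ (T.emit j).toList⟩ := by
  obtain ⟨hj, hS', v, hv⟩ := h
  refine (leads_stepAux q T.var).trans ((leads_of_reaches hv).trans ?_)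
  simpa only [zero_add, Function.update_eq_self, ofLabel, Option.elim_none] using
    leads_popDigits (S := S') hS' (i := 0) (by simpa using hj)

theorem exists_output_eq {M : Type} {f : M → A → M} {g : M → A → ℕ} {stk : M → K → List B}
    {m₀ : M} (hfirst : ∀ a, T.Transforms (T.first a) (fun _ => []) (stk (f m₀ a)) (g m₀ a))
    (hnext : ∀ m a, T.Transforms (T.next a) (stk m) (stk (f m a)) (g m a))
    (p : ℕ → A) {st : ℕ → M} (hst₀ : st 0 = m₀) (hst : ∀ n, st (n + 1) = f (st n) (p n)) (n : ℕ) :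
    ∃ t, (T.machine.run p t).output =
      (List.range n).flatMap fun i => (T.emit (g (st i) (p i))).toList := by
  have leads_readNext (n : ℕ) : T.Leads p ⟨start, 0, fun _ => [], []⟩
      ⟨readNext, n + 1, stk (st (n + 1)),
        (List.range (n + 1)).flatMap fun i => (T.emit (g (st i) (p i))).toList⟩ := by
    induction n with
    | zero =>
      refine (leads_of_act_eq_silent (s' := run (T.first (p 0)) T.var) rfl).trans ?_
      simpa [hst, hst₀] using (hfirst (p 0)).leads (n := 0) (o := [])
    | succ n ih =>
      refine ih.trans ((leads_of_act_eq_silent (s' := run (T.next (p (n + 1))) T.var) rfl).trans ?_)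
      rw [List.range_succ (n := n + 1), List.flatMap_append, hst (n + 1)]
      simpa using (hnext (st (n + 1)) (p (n + 1))).leads
  cases n with
  | zero => exact ⟨0, rfl⟩
  | succ n =>
    obtain ⟨t, ht⟩ :=
      leads_readNext n T.machine.init ⟨rfl, rfl, fun _ => StackTape.default_nil, rfl⟩
    exact ⟨t, ht.output_eq⟩

end Simulation

end StackTransducer

end StackPrograms

/-! ## Type-2 machines from computable functions on words -/

section Codes

open Turing Turing.PartrecToTM2

/-- The statement that puts the list `l` on top of the stack `k` and continues with `q`. -/
def pushAll {K B Λ σ : Type} (k : K) (l : List B) (q : TM2.Stmt (fun _ : K => B) Λ σ) :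
    TM2.Stmt (fun _ : K => B) Λ σ :=
  l.foldl (fun q b => TM2.Stmt.push k (fun _ => b) q) q

section PushAll

variable {K B Λ σ : Type} {k : K} {l : List B} {q : TM2.Stmt (fun _ : K => B) Λ σ}

theorem stepAux_pushAll [DecidableEq K] {v : σ} {S : K → List B} :
    TM2.stepAux (pushAll k l q) v S = TM2.stepAux q v (Function.update S k (l ++ S k)) := by
  induction l generalizing q with
  | nil => simp [pushAll]
  | cons b l ih => exact ih.trans (by simp [TM2.stepAux])

theorem supportsStmt_pushAll {s : Finset Λ} (h : TM2.SupportsStmt s q) :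
    TM2.SupportsStmt s (pushAll k l q) := by
  induction l generalizing q with
  | nil => exact h
  | cons _ _ ih => exact ih h

end PushAll

theorem finite_stackIndex : Finite K' :=
  Finite.of_surjective ![K'.main, K'.rev, K'.aux, K'.stack] fun k => by
    cases k
    exacts [⟨0, rfl⟩, ⟨1, rfl⟩, ⟨2, rfl⟩, ⟨3, rfl⟩]

attribute [local instance] finite_stackIndex

theorem trNat_two_mul_add_one (n : ℕ) : trNat (2 * n + 1) = Γ'.bit1 :: trNat n := by
  have h : ((2 * n + 1 : ℕ) : Num) = Num.bit1 (n : Num) := by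
    rw [← Num.bit1_of_bit1, two_mul]
    push_cast
    rfl
  unfold trNat
  rw [h]
  cases (n : Num) <;> rfl

theorem trNat_two_pow_sub_one (j : ℕ) : trNat (2 ^ j - 1) = List.replicate j Γ'.bit1 := by
  induction j with
  | zero => simp
  | succ j ih =>
    have h := Nat.one_le_two_pow (n := j)
    rw [show 2 ^ (j + 1) - 1 = 2 * (2 ^ j - 1) + 1 by rw [pow_succ]; lia, trNat_two_mul_add_one,
      ih, List.replicate_succ]

variable {A : Type}

/-- The stack program that applies the code `c` to the pair of (the number of) the input symbol and
the memory content `s`, which is `s₀` in the beginning. The result is to be the pair of `2 ^ j - 1`,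
which is `j` in unary, and the new memory content. -/
def codeTransducer (c : ToPartrec.Code) (e : A → ℕ) (s₀ bound : ℕ) (emit : ℕ → Option A) :
    StackTransducer A K' Γ' Λ' (Option Γ') where
  tr := tr
  support := codeSupp c Cont'.halt
  first a := pushAll K'.main (trList [e a, s₀]) (TM2.Stmt.goto fun _ => trNormal c Cont'.halt)
  next a := pushAll K'.main (trNat (e a)) (TM2.Stmt.goto fun _ => trNormal c Cont'.halt)
  var := none
  main := K'.main
  digit := Γ'.bit1
  bound := bound
  emit := emit
  supports_tr := fun _ hl =>
    letI : Inhabited Λ' := ⟨trNormal c Cont'.halt⟩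
    (tr_supports c Cont'.halt).2 _ hl
  supports_first := fun _ => supportsStmt_pushAll fun _ => codeSupp_self _ _ (trStmts₁_self _)
  supports_next := fun _ => supportsStmt_pushAll fun _ => codeSupp_self _ _ (trStmts₁_self _)

namespace codeTransducer

/-- The stacks for the memory content `s`. -/
def memory (s : ℕ) : K' → List Γ' := K'.elim (Γ'.cons :: trList [s]) [] [] []

variable {c : ToPartrec.Code} {e : A → ℕ} {s₀ bound : ℕ} {emit : ℕ → Option A}

theorem transforms_of_stepAux_eq_init {q : TM2.Stmt (fun _ : K' => Γ') Λ' (Option Γ')}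
    {S : K' → List Γ'} {x s s' j : ℕ} (hq : TM2.stepAux q none S = init c [x, s])
    (hc : [2 ^ j - 1, s'] ∈ c.eval [x, s]) (hj : j ≤ bound) :
    (codeTransducer c e s₀ bound emit).Transforms q S (memory s') j := by
  have hhalt : PartrecToTM2.halt [2 ^ j - 1, s'] ∈
      StateTransition.eval (TM2.step tr) (init c [x, s]) := by
    rw [tr_eval]
    exact Part.mem_map _ hc
  refine ⟨hj, by simp [memory, codeTransducer], none, ?_⟩
  simpa [hq, Cfg', PartrecToTM2.halt, memory, codeTransducer, trNat_two_pow_sub_one] using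
    (StateTransition.mem_eval.1 hhalt).1

theorem transforms_first {a : A} {s' j : ℕ} (hc : [2 ^ j - 1, s'] ∈ c.eval [e a, s₀])
    (hj : j ≤ bound) :
    (codeTransducer c e s₀ bound emit).Transforms ((codeTransducer c e s₀ bound emit).first a)
      (fun _ => []) (memory s') j := by
  refine transforms_of_stepAux_eq_init ?_ hc hj
  have hempty : (fun _ : K' => ([] : List Γ')) = K'.elim [] [] [] [] := by
    funext k
    cases k <;> rfl
  simp [codeTransducer, stepAux_pushAll, TM2.stepAux, init, hempty]

theorem transforms_next {a : A} {s s' j : ℕ} (hc : [2 ^ j - 1, s'] ∈ c.eval [e a, s])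
    (hj : j ≤ bound) :
    (codeTransducer c e s₀ bound emit).Transforms ((codeTransducer c e s₀ bound emit).next a)
      (memory s) (memory s') j := by
  refine transforms_of_stepAux_eq_init ?_ hc hj
  simp [codeTransducer, stepAux_pushAll, TM2.stepAux, init, memory]

end codeTransducer

theorem exists_code_eval_eq_pair {f g : ℕ → ℕ → ℕ} (hf : Computable₂ f) (hg : Computable₂ g) :
    ∃ c : ToPartrec.Code, ∀ x s, c.eval [x, s] = Part.some [f x s, g x s] := by
  have exists_code {f : ℕ → ℕ → ℕ} (hf : Computable₂ f) :
      ∃ c : ToPartrec.Code, ∀ x s, c.eval [x, s] = Part.some [f x s] := by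
    have hf' : Partrec₂ fun x s => Part.some (f x s) := hf
    obtain ⟨c, hc⟩ := ToPartrec.Code.exists_code (Nat.Partrec'.part_iff₂.2 hf')
    exact ⟨c, fun x s => (hc ⟨[x, s], rfl⟩).trans (Part.map_some _ _)⟩
  obtain ⟨c, hc⟩ := exists_code hf
  obtain ⟨c', hc'⟩ := exists_code hg
  exact ⟨c.cons c', fun x s => by simp [hc, hc']⟩

end Codes

/-- The word `p(0) … p(n - 1)`. -/
def initSeg {A : Type} (p : ℕ → A) (n : ℕ) : List A := (List.range n).map p

section InitSeg

variable {A : Type} {p q : ℕ → A} {m n : ℕ}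

@[simp]
theorem length_initSeg : (initSeg p n).length = n := by simp [initSeg]

theorem initSeg_succ : initSeg p (n + 1) = initSeg p n ++ [p n] := by
  simp [initSeg, List.range_succ]

theorem getElem?_initSeg (h : m < n) : (initSeg p n)[m]? = some (p m) := by
  simp [initSeg, h]

theorem take_initSeg (h : m ≤ n) : (initSeg p n).take m = initSeg p m := by
  rw [initSeg, ← List.map_take, List.take_range, min_eq_left h, initSeg]

end InitSeg

section Criterion

open Encodable Filter

variable {A : Type} [Finite A] [Primcodable A]

theorem primrec_two_pow : Primrec fun n : ℕ => 2 ^ n :=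
  have h : Primrec₂ ((· ^ ·) : ℕ → ℕ → ℕ) := Primrec₂.unpaired'.1 Nat.Primrec.pow
  h.comp (Primrec.const 2) Primrec.id

theorem exists_computable₂_encode {α β γ : Type} [Primcodable α] [Primcodable β] [Primcodable γ]
    {f : β → α → γ} (hf : Computable₂ f) :
    ∃ F : ℕ → ℕ → ℕ, Computable₂ F ∧ ∀ b a, F (encode a) (encode b) = encode (f b a) := by
  refine ⟨fun x s => (encode ((decode (α := α) x).bind fun a =>
    (decode (α := β) s).map fun b => f b a)).pred, ?_, fun b a => by simp⟩
  refine Primrec.pred.to_comp.comp (Computable.encode.comp ?_)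
  refine Computable.option_bind (Computable.decode.comp Computable.fst) ?_
  refine Computable.option_map (Computable.decode.comp (Computable.snd.comp Computable.fst)) ?_
  exact hf.comp Computable.snd (Computable.snd.comp Computable.fst)

theorem exists_machine_output_eq {M : Type} [Primcodable M] {f : M → A → M}
    {g : M → A → Option A} (hf : Computable₂ f) (hg : Computable₂ g) (m₀ : M) :
    ∃ T : Machine A, ∀ p n, ∃ t, (T.run p t).output =
      (List.range n).flatMap fun i => (g ((initSeg p i).foldl f m₀) (p i)).toList := by
  have : Finite Turing.PartrecToTM2.K' := finite_stackIndex
  obtain ⟨F, hF, hFf⟩ := exists_computable₂_encode hf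
  obtain ⟨G, hG, hGg⟩ := exists_computable₂_encode hg
  obtain ⟨c, hc⟩ := exists_code_eval_eq_pair (f := fun x s => 2 ^ G x s - 1)
    (Primrec.nat_sub.to_comp.comp₂ (primrec_two_pow.to_comp.comp₂ hG) (Computable.const 1).to₂) hF
  obtain ⟨bound, hbound⟩ := (Set.finite_range (encode : Option A → ℕ)).bddAbove
  let T := codeTransducer c (encode : A → ℕ) (encode m₀) bound
    fun j => (decode (α := Option A) j).join
  have hcode (m : M) (a : A) :
      [2 ^ encode (g m a) - 1, encode (f m a)] ∈ c.eval [encode a, encode m] := by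
    simp [hc, hFf, hGg]
  refine ⟨T.machine, fun p n => ?_⟩
  have exists_output := T.exists_output_eq (stk := fun m => codeTransducer.memory (encode m))
    (fun a => codeTransducer.transforms_first (hcode m₀ a) (hbound ⟨_, rfl⟩))
    (fun m a => codeTransducer.transforms_next (hcode m a) (hbound ⟨_, rfl⟩))
    p (st := fun i => (initSeg p i).foldl f m₀) rfl (fun i => by simp [initSeg_succ]) n
  simpa [T, codeTransducer] using exists_output

end Criterion

namespace Machine

variable {A : Type} {T : Machine A} {p q q' : ℕ → A}

theorem monotone_output {s t : ℕ} (h : s ≤ t) : (T.run p s).output <+: (T.run p t).output := by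
  induction h with
  | refl => exact List.prefix_rfl
  | @step t _ ih =>
    refine ih.trans ?_
    rw [run, run, Function.iterate_succ_apply']
    exact List.prefix_append _ _

theorem Computes.unique (h : T.Computes p q) (h' : T.Computes p q') : q = q' := by
  funext n
  obtain ⟨t, ht⟩ := h n
  obtain ⟨t', ht'⟩ := h' n
  have at_max {s : ℕ} {x : A} (hs : (T.run p s).output[n]? = some x) (hle : s ≤ max t t') :
      (T.run p (max t t')).output[n]? = some x :=
    (List.getElem?_eq_some_iff.1 hs).elim fun hn hx =>
      List.prefix_iff_getElem?.1 (monotone_output hle) n hn ▸ congrArg some hx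
  exact Option.some_injective _
    ((at_max ht (le_max_left _ _)).symm.trans (at_max ht' (le_max_right _ _)))

/-- The partial function computed by a machine. -/
noncomputable def toPFun (T : Machine A) : (ℕ → A) →. (ℕ → A) := fun p =>
  ⟨∃ q, T.Computes p q, Exists.choose⟩

theorem mem_toPFun : q ∈ T.toPFun p ↔ T.Computes p q :=
  ⟨fun ⟨h, hq⟩ => hq ▸ h.choose_spec,
    fun h => ⟨⟨q, h⟩, Computes.unique (Exists.choose_spec (⟨q, h⟩ : ∃ q, T.Computes p q)) h⟩⟩

end Machine

section Criterion

open Filter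

variable {A : Type}

section Emission

variable {G : List A → List A}

/-- The state of the transducer that writes the words `G(p(0) … p(n - 1))` as they grow: the input
read so far, and the number of symbols written so far. -/
abbrev EmissionState (A : Type) : Type := List A × ℕ

/-- The next symbol to be written. -/
def emitted (G : List A → List A) (s : EmissionState A) (a : A) : Option A :=
  (G (s.1 ++ [a]))[s.2]?

/-- The state after reading the symbol `a`. -/
def advance (G : List A → List A) (s : EmissionState A) (a : A) : EmissionState A :=
  (s.1 ++ [a], s.2 + (emitted G s a).toList.length)

/-- The number of symbols written after reading `p(0) … p(n - 1)`. -/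
def numEmitted (G : List A → List A) (p : ℕ → A) : ℕ → ℕ
  | 0 => 0
  | n + 1 => numEmitted G p n + (emitted G (initSeg p n, numEmitted G p n) (p n)).toList.length

variable {p q : ℕ → A} {L : ℕ → ℕ}

theorem foldl_advance (n : ℕ) :
    (initSeg p n).foldl (advance G) ([], 0) = (initSeg p n, numEmitted G p n) := by
  induction n with
  | zero => rfl
  | succ n ih => simp [initSeg_succ, ih, advance, numEmitted]

theorem emitted_initSeg (hL : ∀ n, G (initSeg p n) = initSeg q (L n)) (n k : ℕ) :
    emitted G (initSeg p n, k) (p n) = if k < L (n + 1) then some (q k) else none := by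
  simp only [emitted, ← initSeg_succ, hL]
  split_ifs with h
  · exact getElem?_initSeg h
  · simpa using h

theorem flatMap_emitted (hL : ∀ n, G (initSeg p n) = initSeg q (L n)) (n : ℕ) :
    ((List.range n).flatMap fun i => (emitted G (initSeg p i, numEmitted G p i) (p i)).toList) =
      initSeg q (numEmitted G p n) := by
  induction n with
  | zero => rfl
  | succ n ih =>
    rw [List.range_succ, List.flatMap_append, ih, numEmitted, emitted_initSeg hL]
    split_ifs <;> simp [initSeg_succ, emitted_initSeg hL, *]

theorem exists_lt_numEmitted (hL : ∀ n, G (initSeg p n) = initSeg q (L n))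
    (hL' : Tendsto L atTop atTop) (k : ℕ) : ∃ n, k < numEmitted G p n := by
  have step (k : ℕ) (h : ∃ n, k ≤ numEmitted G p n) : ∃ n, k < numEmitted G p n := by
    obtain ⟨n, hn⟩ := h
    obtain ⟨m, hm⟩ := (hL'.eventually_gt_atTop k).exists_forall_of_atTop
    have hmono : Monotone (numEmitted G p) := monotone_nat_of_le_succ fun n => Nat.le_add_right _ _
    have hk := hn.trans (hmono (le_max_left n m))
    obtain h | h := hk.lt_or_eq
    · exact ⟨_, h⟩
    · refine ⟨max n m + 1, ?_⟩
      rw [numEmitted, emitted_initSeg hL, ← h, if_pos (hm _ (by lia))]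
      simp
  induction k with
  | zero => exact step 0 ⟨0, le_rfl⟩
  | succ k ih => exact step (k + 1) ih

end Emission

variable [Finite A] [Primcodable A] {M : Type u} {M' : Type v}

theorem computableWrt_of_initSeg {γ : MultiRep A M} {γ' : MultiRep A M'} {f : M →. M'}
    {G : List A → List A} (hG : Computable G)
    (h : ∀ p x, x ∈ γ p → ∀ y ∈ f x, ∃ q, y ∈ γ' q ∧ ∃ L : ℕ → ℕ, Tendsto L atTop atTop ∧
      ∀ n, G (initSeg p n) = initSeg q (L n)) :
    ComputableWrt γ γ' f := by
  have hread : Computable fun x : EmissionState A × A => x.1.1 ++ [x.2] :=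
    Computable.list_concat.comp (Computable.fst.comp Computable.fst) Computable.snd
  have hemitted : Computable₂ (emitted G) :=
    Computable.list_getElem?.comp (hG.comp hread) (Computable.snd.comp Computable.fst)
  have hadvance : Computable₂ (advance G) := by
    refine hread.pair (Primrec.nat_add.to_comp.comp (Computable.snd.comp Computable.fst) ?_)
    refine (Computable.option_casesOn hemitted (Computable.const 0)
      (Computable.const 1).to₂).of_eq fun x => ?_
    cases emitted G x.1 x.2 <;> rfl
  obtain ⟨T, hT⟩ := exists_machine_output_eq hadvance hemitted ([], 0)
  refine ⟨T.toPFun, ⟨T, fun p q => Machine.mem_toPFun⟩, fun p x hx y hy => ?_⟩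
  obtain ⟨q, hq, L, hL', hL⟩ := h p x hx y hy
  refine ⟨q, Machine.mem_toPFun.2 fun k => ?_, hq⟩
  obtain ⟨n, hn⟩ := exists_lt_numEmitted hL hL' k
  obtain ⟨t, ht⟩ := hT p n
  refine ⟨t, ?_⟩
  simp only [ht, foldl_advance, flatMap_emitted hL, getElem?_initSeg hn]

end Criterion

/-! ## Occurrences in words and sequences -/

section WrappedWords

variable {A : Type} [Zero A] [One A]

open Classical in
/-- The word `v` such that `ι(v)` is a prefix of `x`, if there is one. -/
noncomputable def headWord (x : List A) : Option (List A) :=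
  if h : ∃ v, iota v <+: x then some h.choose else none

/-- The list of the words `v` with `v ≪ w`, ordered by the position of `ι(v)` in `w`. It decodes
tuples: see `wrappedWords_wordTuple`. -/
noncomputable def wrappedWords (w : List A) : List (List A) := w.tails.filterMap headWord

/-- A block of an output sequence: a wrapped word, or the filler `1`. -/
def block : Option (List A) → List A
  | none => [1]
  | some w => iota w

theorem length_iota (v : List A) : (iota v).length = 2 * v.length + 5 := by
  simp only [iota, List.length_append, List.length_cons, List.length_nil, List.length_flatMap,
    List.map_const', List.sum_replicate, smul_eq_mul]
  lia

theorem length_block_pos (o : Option (List A)) : 0 < (block o).length := by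
  cases o <;> simp [block, iota]

theorem wordTuple_eq_flatMap_block (us : List (List A)) :
    wordTuple us = (us.map some).flatMap block := by
  simp [wordTuple, List.flatMap_map, block]

variable [NeZero (1 : A)]

theorem headWord_eq_some_iff {v x : List A} : headWord x = some v ↔ iota v <+: x := by
  have prefix_of_eq {v : List A} (h : headWord x = some v) : iota v <+: x := by
    rw [headWord, Option.dite_none_right_eq_some] at h
    obtain ⟨hex, hv⟩ := h
    exact Option.some_injective _ hv ▸ hex.choose_spec
  refine ⟨prefix_of_eq, fun h => ?_⟩
  obtain ⟨v', hv'⟩ : ∃ v', headWord x = some v' := by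
    rw [headWord, dif_pos ⟨v, h⟩]
    exact ⟨_, rfl⟩
  obtain ⟨s, hs⟩ := prefix_of_eq hv'
  obtain ⟨t, rfl⟩ := h
  exact (iota_append_inj hs).1 ▸ hv'

theorem headWord_iota_append (v s : List A) : headWord (iota v ++ s) = some v :=
  headWord_eq_some_iff.2 (List.prefix_append _ _)

theorem headWord_eq_none {x : List A} (h : ¬ [1, 1, 0] <+: x) : headWord x = none := by
  refine Option.eq_none_iff_forall_ne_some.2 fun v hv => h ?_
  exact List.IsPrefix.trans (by simp [iota]) (headWord_eq_some_iff.1 hv)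

theorem mem_wrappedWords {v w : List A} : v ∈ wrappedWords w ↔ OccursW v w := by
  simp only [wrappedWords, List.mem_filterMap, List.mem_tails, headWord_eq_some_iff, OccursW,
    List.infix_iff_prefix_suffix, and_comm]

theorem wrappedWords_cons_of_not_prefix {a : A} {w : List A} (h : ¬ [1, 1, 0] <+: a :: w) :
    wrappedWords (a :: w) = wrappedWords w := by
  simp [wrappedWords, headWord_eq_none h]

theorem wrappedWords_nil : wrappedWords ([] : List A) = [] := by
  simp [wrappedWords, headWord_eq_none]

theorem wrappedWords_zero_cons (s : List A) : wrappedWords (0 :: s) = wrappedWords s :=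
  wrappedWords_cons_of_not_prefix (by simp [NeZero.ne (1 : A)])

theorem wrappedWords_one_cons {s : List A} (h : s[1]? ≠ some 0) :
    wrappedWords (1 :: s) = wrappedWords s := by
  refine wrappedWords_cons_of_not_prefix ?_
  rintro ⟨t, ht⟩
  simp only [List.cons_append, List.nil_append, List.cons.injEq, true_and] at ht
  subst ht
  simp at h

section Append

variable {s : List A} (h0 : s[0]? ≠ some 0) (h1 : s[1]? ≠ some 0)
include h0 h1

theorem wrappedWords_flatMap_append (v : List A) :
    wrappedWords (v.flatMap (fun a => [a, 0]) ++ ([1, 1] ++ s)) = wrappedWords s := by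
  induction v with
  | nil =>
    simp only [List.flatMap_nil, List.nil_append, List.cons_append]
    rw [wrappedWords_one_cons (by simpa using h0), wrappedWords_one_cons h1]
  | cons a v ih =>
    simp only [List.flatMap_cons, List.cons_append, List.nil_append]
    rw [wrappedWords_cons_of_not_prefix (by simp [NeZero.ne (1 : A)]), wrappedWords_zero_cons]
    exact ih

theorem wrappedWords_iota_append (v : List A) :
    wrappedWords (iota v ++ s) = v :: wrappedWords s := by
  have hcons : iota v ++ s = 1 :: 1 :: 0 :: (v.flatMap (fun a => [a, 0]) ++ ([1, 1] ++ s)) := by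
    simp [iota]
  have hhead := headWord_iota_append v s
  rw [hcons] at hhead ⊢
  rw [wrappedWords, List.tails_cons, List.filterMap_cons_some hhead, ← wrappedWords,
    wrappedWords_cons_of_not_prefix (by simp), wrappedWords_zero_cons,
    wrappedWords_flatMap_append h0 h1]

end Append

theorem getElem?_flatMap_block_zero (bs : List (Option (List A))) :
    (bs.flatMap block)[0]? ≠ some 0 := by
  rcases bs with _ | ⟨_ | w, bs⟩ <;> simp [block, iota, NeZero.ne (1 : A)]

theorem getElem?_flatMap_block_one (bs : List (Option (List A))) :
    (bs.flatMap block)[1]? ≠ some 0 := by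
  rcases bs with _ | ⟨_ | w, bs⟩
  · simp
  · simpa [block] using getElem?_flatMap_block_zero bs
  · simp [block, iota, NeZero.ne (1 : A)]

theorem wrappedWords_flatMap_block (bs : List (Option (List A))) :
    wrappedWords (bs.flatMap block) = bs.filterMap id := by
  induction bs with
  | nil => simp [wrappedWords_nil]
  | cons b bs ih =>
    rw [List.flatMap_cons]
    cases b with
    | none => simpa [block, ih] using wrappedWords_one_cons (getElem?_flatMap_block_one bs)
    | some w =>
      simpa [block, ih] using wrappedWords_iota_append (getElem?_flatMap_block_zero bs)
        (getElem?_flatMap_block_one bs) w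

@[simp]
theorem wrappedWords_wordTuple (us : List (List A)) : wrappedWords (wordTuple us) = us := by
  rw [wordTuple_eq_flatMap_block, wrappedWords_flatMap_block]
  simp [List.filterMap_map]

end WrappedWords

section Sequences

variable {A : Type} [Zero A] [One A]

theorem occurs_iff_exists_occursW_initSeg {v : List A} {p : ℕ → A} :
    Occurs v p ↔ ∃ n, OccursW v (initSeg p n) := by
  constructor
  · rintro ⟨k, hk⟩
    refine ⟨k + (iota v).length, initSeg p k, [], ?_⟩
    have hiota : iota v = (List.range (iota v).length).map fun i => p (k + i) :=
      List.ext_getElem (by simp) fun i hi _ => by simpa using hk i hi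
    rw [List.append_nil, hiota]
    simp [initSeg, List.range_add]
  · rintro ⟨n, x, y, h⟩
    refine ⟨x.length, fun i hi => ?_⟩
    have hlen := congrArg List.length h
    simp only [List.length_append, length_initSeg] at hlen
    have hget := getElem?_initSeg (p := p) (show x.length + i < n by lia)
    rw [← h, List.append_assoc, List.getElem?_append_right (by lia), Nat.add_sub_cancel_left,
      List.getElem?_append_left hi, List.getElem?_eq_getElem hi] at hget
    exact Option.some_injective _ hget

/-- The first `m` blocks of a sequence of blocks. -/
def blocks (E : ℕ → Option (List A)) (m : ℕ) : List A :=
  ((List.range m).map E).flatMap block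

/-- The concatenation of a sequence of blocks. -/
def blockSeq (E : ℕ → Option (List A)) : ℕ → A := fun j => (blocks E (j + 1)).getD j 1

section BlockSeq

variable (E : ℕ → Option (List A)) {m n : ℕ}

theorem blocks_succ : blocks E (m + 1) = blocks E m ++ block (E m) := by
  simp [blocks, List.range_succ]

theorem le_length_blocks : m ≤ (blocks E m).length := by
  induction m with
  | zero => simp
  | succ m ih =>
    have := length_block_pos (E m)
    rw [blocks_succ, List.length_append]
    lia

theorem blocks_prefix (h : m ≤ n) : blocks E m <+: blocks E n := by
  induction h with
  | refl => exact List.prefix_rfl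
  | step _ ih => exact ih.trans (blocks_succ E ▸ List.prefix_append _ _)

theorem blocks_eq_initSeg : blocks E m = initSeg (blockSeq E) (blocks E m).length := by
  refine List.ext_getElem (by simp) fun j h _ => ?_
  have hj : j < (blocks E (j + 1)).length := le_length_blocks E
  simp only [initSeg, List.getElem_map, List.getElem_range, blockSeq, List.getD_eq_getElem _ _ hj]
  obtain hm | hm := le_total m (j + 1)
  · exact (blocks_prefix E hm).getElem h
  · exact ((blocks_prefix E hm).getElem hj).symm

theorem take_blocks (h : n ≤ m) : (blocks E m).take n = initSeg (blockSeq E) n := by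
  rw [blocks_eq_initSeg, take_initSeg (h.trans (le_length_blocks E))]

theorem occurs_blockSeq [NeZero (1 : A)] {v : List A} :
    Occurs v (blockSeq E) ↔ ∃ m, E m = some v := by
  have mem_blocks (m : ℕ) : OccursW v (blocks E m) ↔ ∃ i < m, E i = some v := by
    simp [← mem_wrappedWords, blocks, wrappedWords_flatMap_block]
  rw [occurs_iff_exists_occursW_initSeg]
  constructor
  · rintro ⟨n, hn⟩
    rw [← take_blocks E le_rfl] at hn
    obtain ⟨m, -, hm⟩ := (mem_blocks n).1 (hn.trans (List.take_prefix _ _).isInfix)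
    exact ⟨m, hm⟩
  · rintro ⟨m, hm⟩
    refine ⟨(blocks E (m + 1)).length, ?_⟩
    rw [← blocks_eq_initSeg]
    exact (mem_blocks _).2 ⟨m, m.lt_succ_self, hm⟩

end BlockSeq

end Sequences

/-! ## Properties that can be verified from prefixes -/

open Filter

section Verifies

variable {A : Type}

/-- The property `R` of words semidecides the statement `P` about the sequence `p`: it
holds for some prefix of `p` only if `P` is true, and then it holds for all long prefixes. -/
def Verifies (p : ℕ → A) (R : List A → Prop) (P : Prop) : Prop :=
  (∀ m, R (initSeg p m) → P) ∧ (P → ∀ᶠ m in atTop, R (initSeg p m))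

namespace Verifies

variable {p : ℕ → A} {R R' : List A → Prop} {P P' : Prop} {ι : Type*} {S : ι → List A → Prop}
  {Q : ι → Prop}

theorem const (P : Prop) : Verifies p (fun _ => P) P :=
  ⟨fun _ h => h, fun h => Eventually.of_forall fun _ => h⟩

theorem congr (h : Verifies p R P) (hP : P ↔ P') : Verifies p R P' := propext hP ▸ h

theorem and (h : Verifies p R P) (h' : Verifies p R' P') :
    Verifies p (fun l => R l ∧ R' l) (P ∧ P') :=
  ⟨fun m hm => ⟨h.1 m hm.1, h'.1 m hm.2⟩, fun hP => (h.2 hP.1).and (h'.2 hP.2)⟩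

theorem or (h : Verifies p R P) (h' : Verifies p R' P') :
    Verifies p (fun l => R l ∨ R' l) (P ∨ P') :=
  ⟨fun m hm => hm.imp (h.1 m) (h'.1 m), fun hP => hP.elim
    (fun hP => (h.2 hP).mono fun _ => Or.inl) fun hP => (h'.2 hP).mono fun _ => Or.inr⟩

theorem exists_of_forall (h : ∀ i, Verifies p (S i) (Q i)) :
    Verifies p (fun l => ∃ i, S i l) (∃ i, Q i) :=
  ⟨fun m ⟨i, hi⟩ => ⟨i, (h i).1 m hi⟩, fun ⟨i, hi⟩ => ((h i).2 hi).mono fun _ hm => ⟨i, hm⟩⟩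

theorem forall_mem_finite {s : Set ι} (hs : s.Finite) (h : ∀ i ∈ s, Verifies p (S i) (Q i)) :
    Verifies p (fun l => ∀ i ∈ s, S i l) (∀ i ∈ s, Q i) :=
  ⟨fun m hm i hi => (h i hi).1 m (hm i hi),
    fun hQ => (eventually_all_finite hs).2 fun i hi => (h i hi).2 (hQ i hi)⟩

theorem forall_mem_list {L : List ι} (h : ∀ i ∈ L, Verifies p (S i) (Q i)) :
    Verifies p (fun l => ∀ i ∈ L, S i l) (∀ i ∈ L, Q i) :=
  forall_mem_finite L.finite_toSet h

theorem forall_lt {n : ℕ} {S : ℕ → List A → Prop} {Q : ℕ → Prop}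
    (h : ∀ i < n, Verifies p (S i) (Q i)) :
    Verifies p (fun l => ∀ i < n, S i l) (∀ i < n, Q i) :=
  forall_mem_finite (Set.finite_Iio n) h

theorem exists_lt_length {S : ℕ → List A → Prop} {Q : ℕ → Prop}
    (h : ∀ i, Verifies p (S i) (Q i)) :
    Verifies p (fun l => ∃ i < l.length, S i l) (∃ i, Q i) := by
  have lt_length (i : ℕ) : Verifies p (fun l => i < l.length) True :=
    ⟨fun _ _ => trivial, fun _ => by simpa using eventually_gt_atTop i⟩
  exact (Verifies.exists_of_forall fun i => (lt_length i).and (h i)).congr (by simp)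

end Verifies

end Verifies

section Subsequences

variable {A : Type}

/-- The prefix of the subsequence `p ∘ φ` that is determined by the prefix `l` of `p`. -/
def subseqPrefix (φ : ℕ → ℕ) (l : List A) : List A :=
  (List.range l.length).filterMap fun j => l[φ j]?

theorem subseqPrefix_initSeg {φ : ℕ → ℕ} (hφ : StrictMono φ) (p : ℕ → A) {n m : ℕ}
    (hm : ∀ j, φ j < n ↔ j < m) : subseqPrefix φ (initSeg p n) = initSeg (p ∘ φ) m := by
  have hmn : m ≤ n := not_lt.1 fun h => ((hm n).2 h).not_ge hφ.le_apply
  obtain ⟨k, rfl⟩ := exists_add_of_le hmn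
  have hlt : ∀ j ∈ List.range m, (initSeg p (m + k))[φ j]? = some (p (φ j)) := fun j hj =>
    getElem?_initSeg ((hm j).2 (List.mem_range.1 hj))
  have hge : ∀ j ∈ (List.range k).map (m + ·), (initSeg p (m + k))[φ j]? = none := by
    simp only [List.forall_mem_map, List.getElem?_eq_none_iff, length_initSeg]
    exact fun j _ => not_lt.1 fun hlt => by simpa using (hm (m + j)).1 hlt
  rw [subseqPrefix, length_initSeg, List.range_add, List.filterMap_append,
    List.filterMap_eq_nil_iff.2 hge, List.append_nil, List.filterMap_congr hlt, initSeg]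
  exact congrFun List.filterMap_eq_map _

theorem exists_lt_iff_lt {φ : ℕ → ℕ} (hφ : StrictMono φ) (n : ℕ) :
    ∃ m, ∀ j, φ j < n ↔ j < m := by
  have hex : ∃ j, n ≤ φ j := ⟨n, hφ.le_apply⟩
  refine ⟨Nat.find hex, fun j => ⟨fun h => ?_, fun h => not_le.1 (Nat.find_min hex h)⟩⟩
  exact hφ.lt_iff_lt.1 (h.trans_le (Nat.find_spec hex))

theorem verifies_occursW_subseqPrefix [Zero A] [One A] {φ : ℕ → ℕ} (hφ : StrictMono φ)
    (p : ℕ → A) (v : List A) :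
    Verifies p (fun l => OccursW v (subseqPrefix φ l)) (Occurs v (p ∘ φ)) := by
  constructor
  · intro n h
    obtain ⟨m, hm⟩ := exists_lt_iff_lt hφ n
    rw [subseqPrefix_initSeg hφ p hm] at h
    exact occurs_iff_exists_occursW_initSeg.2 ⟨m, h⟩
  · intro h
    obtain ⟨k, hk⟩ := occurs_iff_exists_occursW_initSeg.1 h
    filter_upwards [eventually_ge_atTop (φ k)] with n hn
    obtain ⟨m, hm⟩ := exists_lt_iff_lt hφ n
    have hkm : k ≤ m := not_lt.1 fun hlt => ((hm m).1 ((hφ hlt).trans_le hn)).false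
    rw [subseqPrefix_initSeg hφ p hm]
    rw [← take_initSeg hkm] at hk
    exact hk.trans (List.take_prefix _ _).isInfix

end Subsequences

section Enumerations

open Encodable

variable {A : Type} [Encodable A]

open Classical in
/-- The word that is listed at the time when the prefix `l` of the input has been read, in the
enumeration of the words `w` such that `R w l` for some prefix `l`. Every word is considered at
infinitely many times. -/
noncomputable def listed (R : List A → List A → Prop) (l : List A) : Option (List A) :=
  (decode (α := List A) l.length.unpair.1).filter fun w => R w l

variable [Zero A] [One A] {R : List A → List A → Prop} {p : ℕ → A}

/-- The sequence that lists the words `w` such that `R w l` for some prefix `l` of `p`. -/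
noncomputable def enumSeq (R : List A → List A → Prop) (p : ℕ → A) : ℕ → A :=
  blockSeq fun m => listed R (initSeg p m)

/-- The prefix of the enumeration that is determined by the prefix `l` of the input. -/
noncomputable def enumPrefix (R : List A → List A → Prop) (l : List A) : List A :=
  (blocks (fun m => listed R (l.take m)) l.length).take l.length

theorem enumPrefix_initSeg (n : ℕ) : enumPrefix R (initSeg p n) = initSeg (enumSeq R p) n := by
  have hlisted : ∀ m ∈ List.range n,
      listed R ((initSeg p n).take m) = listed R (initSeg p m) := fun m hm => by
    rw [take_initSeg (List.mem_range.1 hm).le]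
  rw [enumPrefix, length_initSeg, blocks, List.map_congr_left hlisted]
  exact take_blocks _ le_rfl

theorem occurs_enumSeq [NeZero (1 : A)] {P : List A → Prop} {v : List A}
    (h : Verifies p (R v) (P v)) : Occurs v (enumSeq R p) ↔ P v := by
  simp only [enumSeq, occurs_blockSeq, listed, Option.filter_eq_some_iff, decide_eq_true_eq]
  constructor
  · rintro ⟨m, -, hR⟩
    exact h.1 m hR
  · intro hv
    obtain ⟨k, hk⟩ := eventually_atTop.1 (h.2 hv)
    exact ⟨Nat.pair (encode v) k, by simp, hk _ (Nat.right_le_pair _ _)⟩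

end Enumerations

/-! ## Points of base elements -/

section Points

variable {A : Type}

/-- The point `x` lies in the base element with the name `w`. -/
def InBase (X : EffSpace.{u} A) (w : List A) (x : X.carrier) : Prop := ∃ U ∈ X.ν w, x ∈ U

theorem InBase.mem_dom {X : EffSpace.{u} A} {w : List A} {x : X.carrier} (h : InBase X w x) :
    w ∈ X.ν.Dom := by
  obtain ⟨U, hU, -⟩ := h
  exact Part.dom_iff_mem.2 ⟨U, hU⟩

theorem inBase_iff_of_mem {X : EffSpace.{u} A} {w : List A} {U : Set X.carrier} (hU : U ∈ X.ν w)
    {x : X.carrier} : InBase X w x ↔ x ∈ U :=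
  ⟨fun ⟨_, hV, hx⟩ => Part.mem_unique hV hU ▸ hx, fun hx => ⟨U, hU, hx⟩⟩

theorem exists_inBase (X : EffSpace.{u} A) (x : X.carrier) : ∃ w, InBase X w x := by
  obtain ⟨U, ⟨w, hU⟩, hx, -⟩ := X.isBase.exists_subset_of_mem_open (Set.mem_univ x) isOpen_univ
  exact ⟨w, U, hU, hx⟩

theorem isOpen_setOf_inBase (X : EffSpace.{u} A) (w : List A) : IsOpen {x | InBase X w x} := by
  by_cases h : w ∈ X.ν.Dom
  · obtain ⟨U, hU⟩ := Part.dom_iff_mem.1 h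
    have : {x | InBase X w x} = U := Set.ext fun x => inBase_iff_of_mem hU
    exact this ▸ X.isBase.isOpen ⟨w, hU⟩
  · convert isOpen_empty
    exact Set.eq_empty_of_forall_notMem fun x hx => h hx.mem_dom

theorem exists_finite_cover {X : EffSpace.{u} A} {K : Set X.carrier} (hK : IsCompact K) :
    ∃ F : Set (List A), F.Finite ∧ ∀ x ∈ K, ∃ v ∈ F, InBase X v x := by
  obtain ⟨t, ht⟩ := hK.elim_finite_subcover (fun w => {x | InBase X w x})
    (isOpen_setOf_inBase X) fun x _ => Set.mem_iUnion.2 (exists_inBase X x)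
  exact ⟨t, t.finite_toSet, fun x hx => by simpa using ht hx⟩

/-- The relation `T` between names of base elements describes the intersections of base elements
of `X` as unions of base elements; the second part of a `Δ`-name lists such a relation. -/
structure IsIntersectionRel (X : EffSpace.{u} A) (T : List A → List A → List A → Prop) :
    Prop where
  mem_dom : ∀ u v w, T u v w → u ∈ X.ν.Dom ∧ v ∈ X.ν.Dom ∧ w ∈ X.ν.Dom
  inBase_and_iff : ∀ u ∈ X.ν.Dom, ∀ v ∈ X.ν.Dom, ∀ x,
    InBase X u x ∧ InBase X v x ↔ ∃ w, T u v w ∧ InBase X w x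

variable [Zero A] [One A]

theorem mem_Delta_iff {X : EffSpace.{u} A} {t : ℕ → A} :
    X ∈ Delta t ↔
      (∀ z, Occurs z (comp 2 0 t) ↔
        ∃ w, (w ∈ X.ν.Dom ∧ z = wordTuple [w, [1]]) ∨ (w ∉ X.ν.Dom ∧ z = wordTuple [w, [0]])) ∧
      ∃ T, IsIntersectionRel X T ∧
        ∀ z, Occurs z (comp 2 1 t) ↔ ∃ u v w, T u v w ∧ z = wordTuple [u, v, w] := by
  have mem_union {S : Set (List A × List A × List A)} {u v : List A} {x : X.carrier} :
      x ∈ ⋃₀ {W | ∃ w, (u, v, w) ∈ S ∧ W ∈ X.ν w} ↔ ∃ w, (u, v, w) ∈ S ∧ InBase X w x :=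
    ⟨fun ⟨W, ⟨w, hS, hW⟩, hx⟩ => ⟨w, hS, W, hW, hx⟩,
      fun ⟨w, hS, W, hW, hx⟩ => ⟨W, ⟨w, hS, hW⟩, hx⟩⟩
  refine and_congr_right fun _ => ⟨?_, ?_⟩
  · rintro ⟨S, hdom, hocc, hinter⟩
    refine ⟨fun u v w => (u, v, w) ∈ S, ⟨hdom, fun u hu v hv x => ?_⟩, hocc⟩
    rw [inBase_iff_of_mem (Part.get_mem hu), inBase_iff_of_mem (Part.get_mem hv), ← mem_union,
      ← hinter u v _ (Part.get_mem hu) _ (Part.get_mem hv), Set.mem_inter_iff]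
  · rintro ⟨T, hT, hocc⟩
    refine ⟨{t | T t.1 t.2.1 t.2.2}, hT.mem_dom, hocc, fun u v U hU V hV => Set.ext fun x => ?_⟩
    rw [mem_union, Set.mem_inter_iff, ← inBase_iff_of_mem hU, ← inBase_iff_of_mem hV]
    exact hT.inBase_and_iff u (Part.dom_iff_mem.2 ⟨U, hU⟩) v (Part.dom_iff_mem.2 ⟨V, hV⟩) x

variable [NeZero (1 : A)]

theorem occurs_wordTuple_one_iff {X : EffSpace.{u} A} {t : ℕ → A} (h : X ∈ Delta t)
    (u : List A) : Occurs (wordTuple [u, [1]]) (comp 2 0 t) ↔ u ∈ X.ν.Dom := by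
  simp [h.1, wordTuple_injective.eq_iff, NeZero.ne (1 : A)]

theorem occurs_wordTuple_zero_iff {X : EffSpace.{u} A} {t : ℕ → A} (h : X ∈ Delta t)
    (u : List A) : Occurs (wordTuple [u, [0]]) (comp 2 0 t) ↔ u ∉ X.ν.Dom := by
  simp [h.1, wordTuple_injective.eq_iff, (NeZero.ne (1 : A)).symm]

variable {X : EffSpace.{u} A} {K : Set X.carrier} {s : ℕ → A}

theorem mem_kappaTilde_iff :
    K ∈ kappaTilde X s ↔ ∀ w, Occurs w s ↔
      (∀ v ∈ wrappedWords w, ∃ x ∈ K, InBase X v x) ∧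
        ∀ x ∈ K, ∃ v ∈ wrappedWords w, InBase X v x := by
  simp only [mem_wrappedWords]
  refine forall_congr' fun w => iff_congr Iff.rfl ⟨?_, ?_⟩
  · rintro ⟨⟨W, ⟨_, rfl⟩, hcover⟩, hmeet⟩
    refine ⟨fun v hv => ?_, fun x hx => ?_⟩
    · obtain ⟨U, hU, x, hxU, hxK⟩ := hmeet v hv
      exact ⟨x, hxK, U, hU, hxU⟩
    · obtain ⟨U, ⟨v, hv, hU⟩, hxU⟩ := hcover hx
      exact ⟨v, hv, U, hU, hxU⟩
  · rintro ⟨hmeet, hcover⟩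
    refine ⟨⟨_, ⟨fun v hv => ?_, rfl⟩, fun x hx => ?_⟩, fun v hv => ?_⟩
    · obtain ⟨x, -, hx⟩ := hmeet v hv
      exact hx.mem_dom
    · obtain ⟨v, hv, U, hU, hxU⟩ := hcover x hx
      exact ⟨U, ⟨v, hv, hU⟩, hxU⟩
    · obtain ⟨x, hxK, U, hU, hxU⟩ := hmeet v hv
      exact ⟨U, hU, x, hxU, hxK⟩

theorem exists_occurs_of_finite_cover (h : K ∈ kappaTilde X s) {F : Set (List A)}
    (hF : F.Finite) (hcover : ∀ x ∈ K, ∃ v ∈ F, InBase X v x) :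
    ∃ w, Occurs w s ∧ ∀ v, v ∈ wrappedWords w ↔ v ∈ F ∧ ∃ x ∈ K, InBase X v x := by
  have hfin : {v | v ∈ F ∧ ∃ x ∈ K, InBase X v x}.Finite := hF.subset fun v hv => hv.1
  refine ⟨wordTuple hfin.toFinset.toList, ?_, by simp⟩
  rw [mem_kappaTilde_iff.1 h]
  simp only [wrappedWords_wordTuple, Finset.mem_toList, Set.Finite.mem_toFinset]
  refine ⟨fun v hv => hv.2, fun x hx => ?_⟩
  obtain ⟨v, hv, hvx⟩ := hcover x hx
  exact ⟨v, ⟨hv, x, hx, hvx⟩, hvx⟩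

theorem exists_occurs_subset_iff (h : K ∈ kappaTilde X s) {F : Set (List A)} (hF : F.Finite) :
    (∃ w, Occurs w s ∧ ∀ v ∈ wrappedWords w, v ∈ F) ↔ ∀ x ∈ K, ∃ v ∈ F, InBase X v x := by
  constructor
  · rintro ⟨w, hw, hwF⟩ x hx
    obtain ⟨v, hv, hvx⟩ := ((mem_kappaTilde_iff.1 h w).1 hw).2 x hx
    exact ⟨v, hwF v hv, hvx⟩
  · intro hcover
    obtain ⟨w, hw, hmem⟩ := exists_occurs_of_finite_cover h hF hcover
    exact ⟨w, hw, fun v hv => ((hmem v).1 hv).1⟩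

theorem exists_occurs_mem_iff (h : K ∈ kappaTilde X s) (hK : IsCompact K) (u : List A) :
    (∃ w, Occurs w s ∧ u ∈ wrappedWords w) ↔ ∃ x ∈ K, InBase X u x := by
  constructor
  · rintro ⟨w, hw, hu⟩
    exact ((mem_kappaTilde_iff.1 h w).1 hw).1 u hu
  · intro hu
    obtain ⟨F, hF, hcover⟩ := exists_finite_cover hK
    obtain ⟨w, hw, hmem⟩ := exists_occurs_of_finite_cover h (hF.insert u) fun x hx => by
      obtain ⟨v, hv, hvx⟩ := hcover x hx
      exact ⟨v, Set.mem_insert_of_mem u hv, hvx⟩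
    exact ⟨w, hw, (hmem u).2 ⟨Set.mem_insert u F, hu⟩⟩

end Points

/-! ## Products of base elements -/

section Tuples

variable {A : Type} [Zero A] [One A]

/-- The component number `i` of the tuple `w`, and the empty word if there is none. -/
noncomputable def component (w : List A) (i : ℕ) : List A := (wrappedWords w).getD i []

/-- The word `w` is a tuple of words of an admissible length such that the component number `i`
has the property `P i`, for all `i`. -/
def IsTupleWith (admissible : ℕ → Prop) (P : ℕ → List A → Prop) (w : List A) : Prop :=
  wordTuple (wrappedWords w) = w ∧ admissible (wrappedWords w).length ∧
    ∀ i < (wrappedWords w).length, P i (component w i)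

/-- The components of a tuple with their positions. -/
noncomputable def indexed (v : List A) : List (List A × ℕ) :=
  (List.range (wrappedWords v).length).map fun i => (component v i, i)

/-- The name `x` is a component number `i` for the intersection of the boxes with the names `u`
and `v`, given relations `T i` that describe the intersections in the factors; a missing
component stands for a whole factor. -/
def IntersectionAt (T : ℕ → List A → List A → List A → Prop) (u v : List A) (i : ℕ)
    (x : List A) : Prop :=
  (i < (wrappedWords u).length ∧ i < (wrappedWords v).length ∧
      T i (component u i) (component v i) x) ∨
    ((wrappedWords v).length ≤ i ∧ x = component u i) ∨
    ((wrappedWords u).length ≤ i ∧ x = component v i)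

/-- The relation for the intersections of boxes, given by domains `D i` and relations `T i` for
the intersections in the factors. -/
def TupleIntersection (admissible : ℕ → Prop) (D : ℕ → List A → Prop)
    (T : ℕ → List A → List A → List A → Prop) (u v w : List A) : Prop :=
  IsTupleWith admissible D u ∧ IsTupleWith admissible D v ∧
    (wrappedWords w).length = max (wrappedWords u).length (wrappedWords v).length ∧
    IsTupleWith admissible (IntersectionAt T u v) w

variable {admissible : ℕ → Prop} {P Q : ℕ → List A → Prop} {w : List A}

theorem IsTupleWith.imp (h : IsTupleWith admissible P w)
    (hPQ : ∀ i < (wrappedWords w).length, P i (component w i) → Q i (component w i)) :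
    IsTupleWith admissible Q w :=
  ⟨h.1, h.2.1, fun i hi => hPQ i hi (h.2.2 i hi)⟩

variable [NeZero (1 : A)]

theorem component_wordTuple {us : List (List A)} {i : ℕ} (hi : i < us.length) :
    component (wordTuple us) i = us[i] := by
  rw [component, wrappedWords_wordTuple, List.getD_eq_getElem _ _ hi]

theorem isTupleWith_iff_exists : IsTupleWith admissible P w ↔
    ∃ us : List (List A), admissible us.length ∧ w = wordTuple us ∧
      ∀ (i : ℕ) (h : i < us.length), P i us[i] := by
  constructor
  · rintro ⟨htuple, hlen, hP⟩
    refine ⟨wrappedWords w, hlen, htuple.symm, fun i hi => ?_⟩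
    simpa only [component, List.getD_eq_getElem _ _ hi] using hP i hi
  · rintro ⟨us, hlen, rfl, hP⟩
    rw [IsTupleWith, wrappedWords_wordTuple]
    exact ⟨rfl, hlen, fun i hi => component_wordTuple hi ▸ hP i hi⟩

theorem isTupleWith_wordTuple_range {n : ℕ} (hn : admissible n) {f : ℕ → List A}
    (hf : ∀ i < n, P i (f i)) : IsTupleWith admissible P (wordTuple ((List.range n).map f)) :=
  isTupleWith_iff_exists.2 ⟨_, by simpa using hn, rfl, fun i hi => by
    simpa using hf i (by simpa using hi)⟩

end Tuples

section Sections

variable {β : Type*} {L : List (List β)}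

theorem exists_mem_forall_mem_iff_forall_sections {P : β → Prop} :
    (∃ l ∈ L, ∀ b ∈ l, P b) ↔ ∀ c ∈ L.sections, ∃ b ∈ c, P b := by
  induction L with
  | nil => simp
  | cons l L ih =>
    simp only [List.mem_cons, exists_eq_or_imp, ih, List.sections, List.mem_flatMap, List.mem_map,
      forall_exists_index, and_imp]
    constructor
    · rintro (h | h) _ c hc b hb rfl
      · exact ⟨b, by simp, h b hb⟩
      · obtain ⟨b', hb', hP⟩ := h c hc
        exact ⟨b', by simp [hb'], hP⟩
    · intro h
      by_contra! hne
      obtain ⟨⟨b, hb, hPb⟩, c, hc, hPc⟩ := hne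
      obtain ⟨b', hb', hP⟩ := h _ c hc b hb rfl
      rcases List.mem_cons.1 hb' with rfl | hb'
      · exact hPb hP
      · exact hPc b' hb' hP

theorem exists_mem_of_mem_sections {c : List β} (hc : c ∈ L.sections) {b : β} (hb : b ∈ c) :
    ∃ l ∈ L, b ∈ l := by
  rw [List.mem_sections] at hc
  obtain ⟨i, hi, rfl⟩ := List.getElem_of_mem hb
  exact ⟨L[i]'(hc.length_eq ▸ hi), List.getElem_mem _, hc.get hi _⟩

end Sections

/-- The pair `Y` behaves like a product of the pairs `C i`, where `proj` maps a point to its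
coordinates. Its base elements are named by the tuples of an admissible length, and `Y` need not
have coordinates with numbers that do not occur in such tuples. -/
structure IsProduct {A : Type} [Zero A] [One A] (C : ℕ → CompactPair.{u} A)
    (admissible : ℕ → Prop) (Y : CompactPair.{u} A)
    (proj : Y.space.carrier → ∀ i, (C i).space.carrier) : Prop where
  mem_dom_iff : ∀ w, w ∈ Y.space.ν.Dom ↔
    IsTupleWith admissible (fun i u => u ∈ (C i).space.ν.Dom) w
  inBase_iff : ∀ w y, InBase Y.space w y ↔
    IsTupleWith admissible (fun i u => InBase (C i).space u (proj y i)) w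
  proj_mem : ∀ y ∈ Y.set, ∀ i, proj y i ∈ (C i).set
  exists_proj_eq : ∀ x : ∀ i, (C i).space.carrier, (∀ i, x i ∈ (C i).set) →
    ∃ y ∈ Y.set, ∀ n, admissible n → ∀ i < n, proj y i = x i
  nonempty : ∀ n, admissible n → (∀ i < n, (C i).set.Nonempty) → ∀ i, (C i).set.Nonempty

namespace IsProduct

variable {A : Type} [Zero A] [One A] {C : ℕ → CompactPair.{u} A} {admissible : ℕ → Prop}
  {Y : CompactPair.{u} A} {proj : Y.space.carrier → ∀ i, (C i).space.carrier}
  (hY : IsProduct C admissible Y proj)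
include hY

theorem exists_mem_inBase_iff (v : List A) : (∃ y ∈ Y.set, InBase Y.space v y) ↔
    IsTupleWith admissible (fun i u => ∃ x ∈ (C i).set, InBase (C i).space u x) v := by
  constructor
  · rintro ⟨y, hy, h⟩
    exact ((hY.inBase_iff v y).1 h).imp fun i _ hb => ⟨proj y i, hY.proj_mem y hy i, hb⟩
  · intro h
    have hne := hY.nonempty _ h.2.1 fun i hi => (h.2.2 i hi).imp fun x hx => hx.1
    have hex : ∀ i, ∃ x ∈ (C i).set,
        i < (wrappedWords v).length → InBase (C i).space (component v i) x := fun i => by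
      by_cases hi : i < (wrappedWords v).length
      · exact (h.2.2 i hi).imp fun x hx => ⟨hx.1, fun _ => hx.2⟩
      · exact (hne i).imp fun x hx => ⟨hx, fun hlt => absurd hlt hi⟩
    choose x hx hb using hex
    obtain ⟨y, hy, hyx⟩ := hY.exists_proj_eq x hx
    refine ⟨y, hy, (hY.inBase_iff v y).2 (h.imp fun i hi _ => ?_)⟩
    rw [hyx _ h.2.1 i hi]
    exact hb i hi

/-- An element of `(F.map indexed).sections` chooses one side of each box. -/
theorem cover_iff {F : List (List A)} (hF : ∀ v ∈ F, ∃ P, IsTupleWith admissible P v) :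
    (∀ y ∈ Y.set, ∃ v ∈ F, InBase Y.space v y) ↔
      ∀ c ∈ (F.map indexed).sections, ∃ i, ∀ x ∈ (C i).set, ∃ u, (u, i) ∈ c ∧
        InBase (C i).space u x := by
  have inBase_iff_indexed (y) : ∀ v ∈ F, (InBase Y.space v y ↔
      ∀ b ∈ indexed v, InBase (C b.2).space b.1 (proj y b.2)) := fun v hv => by
    obtain ⟨P, htuple, hlen, -⟩ := hF v hv
    simp [hY.inBase_iff, IsTupleWith, htuple, hlen, indexed]
  have cover_iff_sections (y) : (∃ v ∈ F, InBase Y.space v y) ↔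
      ∀ c ∈ (F.map indexed).sections, ∃ b ∈ c, InBase (C b.2).space b.1 (proj y b.2) := by
    simp only [← exists_mem_forall_mem_iff_forall_sections, List.mem_map, exists_exists_and_eq_and]
    exact exists_congr fun v => and_congr_right (inBase_iff_indexed y v)
  simp only [cover_iff_sections]
  constructor
  · intro h c hc
    by_contra! hne
    choose x hx hxc using hne
    obtain ⟨y, hy, hyx⟩ := hY.exists_proj_eq x hx
    obtain ⟨⟨u, i⟩, hb, hbase⟩ := h y hy c hc
    obtain ⟨_, hl, hbl⟩ := exists_mem_of_mem_sections hc hb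
    obtain ⟨v, hv, rfl⟩ := List.mem_map.1 hl
    obtain ⟨P, -, hlen, -⟩ := hF v hv
    have hi : i < (wrappedWords v).length := by
      simp only [indexed, List.mem_map, List.mem_range, Prod.mk.injEq] at hbl
      lia
    exact hxc i u hb (hyx _ hlen i hi ▸ hbase)
  · intro h y hy c hc
    obtain ⟨i, hi⟩ := h c hc
    obtain ⟨u, hu, hbase⟩ := hi _ (hY.proj_mem y hy i)
    exact ⟨(u, i), hu, hbase⟩

section Intersections

variable {T : ℕ → List A → List A → List A → Prop}

theorem mem_dom_of_tupleIntersection (hT : ∀ i, IsIntersectionRel (C i).space (T i))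
    {u v w : List A}
    (h : TupleIntersection admissible (fun i u => u ∈ (C i).space.ν.Dom) T u v w) :
    u ∈ Y.space.ν.Dom ∧ v ∈ Y.space.ν.Dom ∧ w ∈ Y.space.ν.Dom := by
  obtain ⟨hu, hv, hlen, hw⟩ := h
  simp only [hY.mem_dom_iff]
  refine ⟨hu, hv, hw.imp fun i hi hat => ?_⟩
  rcases hat with ⟨-, -, hTi⟩ | ⟨hi', hx⟩ | ⟨hi', hx⟩
  · exact ((hT i).mem_dom _ _ _ hTi).2.2
  · exact hx ▸ hu.2.2 i (by lia)
  · exact hx ▸ hv.2.2 i (by lia)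

theorem inBase_and_of_tupleIntersection (hT : ∀ i, IsIntersectionRel (C i).space (T i))
    {u v w : List A} {y : Y.space.carrier}
    (h : TupleIntersection admissible (fun i u => u ∈ (C i).space.ν.Dom) T u v w)
    (hy : InBase Y.space w y) : InBase Y.space u y ∧ InBase Y.space v y := by
  obtain ⟨hu, hv, hlen, hw⟩ := h
  simp only [hY.inBase_iff] at hy ⊢
  have inBase_both (i : ℕ) (hiu : i < (wrappedWords u).length) (hiv : i < (wrappedWords v).length)
      (hTi : T i (component u i) (component v i) (component w i)) :=
    ((hT i).inBase_and_iff _ (hu.2.2 i hiu) _ (hv.2.2 i hiv) (proj y i)).2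
      ⟨_, hTi, hy.2.2 i (by lia)⟩
  refine ⟨hu.imp fun i hi _ => ?_, hv.imp fun i hi _ => ?_⟩ <;>
    rcases hw.2.2 i (by lia) with ⟨hiu, hiv, hTi⟩ | ⟨hi', hx⟩ | ⟨hi', hx⟩
  · exact (inBase_both i hiu hiv hTi).1
  · exact hx ▸ hy.2.2 i (by lia)
  · exact absurd hi hi'.not_gt
  · exact (inBase_both i hiu hiv hTi).2
  · exact absurd hi hi'.not_gt
  · exact hx ▸ hy.2.2 i (by lia)

theorem exists_tupleIntersection [NeZero (1 : A)]
    (hT : ∀ i, IsIntersectionRel (C i).space (T i)) {u v : List A} {y : Y.space.carrier}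
    (hu : InBase Y.space u y) (hv : InBase Y.space v y) :
    ∃ w, TupleIntersection admissible (fun i u => u ∈ (C i).space.ν.Dom) T u v w ∧
      InBase Y.space w y := by
  have hdu := (hY.mem_dom_iff u).1 hu.mem_dom
  have hdv := (hY.mem_dom_iff v).1 hv.mem_dom
  rw [hY.inBase_iff] at hu hv
  set n := max (wrappedWords u).length (wrappedWords v).length with hn
  have hex : ∀ i, ∃ x, i < n → IntersectionAt T u v i x ∧ InBase (C i).space x (proj y i) := by
    intro i
    by_cases hiu : i < (wrappedWords u).length <;> by_cases hiv : i < (wrappedWords v).length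
    · obtain ⟨x, hx, hbase⟩ := ((hT i).inBase_and_iff _ (hdu.2.2 i hiu) _ (hdv.2.2 i hiv) _).1
        ⟨hu.2.2 i hiu, hv.2.2 i hiv⟩
      exact ⟨x, fun _ => ⟨Or.inl ⟨hiu, hiv, hx⟩, hbase⟩⟩
    · exact ⟨_, fun _ => ⟨Or.inr (Or.inl ⟨not_lt.1 hiv, rfl⟩), hu.2.2 i hiu⟩⟩
    · exact ⟨_, fun _ => ⟨Or.inr (Or.inr ⟨not_lt.1 hiu, rfl⟩), hv.2.2 i hiv⟩⟩
    · exact ⟨[], fun hi => by lia⟩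
  choose f hf using hex
  have hadm : admissible n := by
    rcases max_choice (wrappedWords u).length (wrappedWords v).length with h | h <;> rw [hn, h]
    · exact hu.2.1
    · exact hv.2.1
  exact ⟨wordTuple ((List.range n).map f),
    ⟨hdu, hdv, by simp [n], isTupleWith_wordTuple_range hadm fun i hi => (hf i hi).1⟩,
    (hY.inBase_iff _ _).2 (isTupleWith_wordTuple_range hadm fun i hi => (hf i hi).2)⟩

theorem isIntersectionRel [NeZero (1 : A)] (hT : ∀ i, IsIntersectionRel (C i).space (T i)) :
    IsIntersectionRel Y.space
      (TupleIntersection admissible (fun i u => u ∈ (C i).space.ν.Dom) T) where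
  mem_dom _ _ _ := hY.mem_dom_of_tupleIntersection hT
  inBase_and_iff _ _ _ _ _ :=
    ⟨fun ⟨hu, hv⟩ => hY.exists_tupleIntersection hT hu hv,
      fun ⟨_, hw, hy⟩ => hY.inBase_and_of_tupleIntersection hT hw hy⟩

end Intersections

end IsProduct

/-! ## The name of a product -/

section Merge

variable {A : Type}

/-- The sequence `⟨p, q⟩ = p(0) q(0) p(1) q(1) …`. -/
def merge (p q : ℕ → A) : ℕ → A := fun n => if n % 2 = 0 then p (n / 2) else q (n / 2)

theorem comp_merge_zero (p q : ℕ → A) : comp 2 0 (merge p q) = p := by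
  funext j
  rw [comp, merge, if_pos (by lia), show (2 * j + 0) / 2 = j by lia]

theorem comp_merge_one (p q : ℕ → A) : comp 2 1 (merge p q) = q := by
  funext j
  rw [comp, merge, if_neg (by lia), show (2 * j + 1) / 2 = j by lia]

theorem comp_comp (n i m k : ℕ) (q : ℕ → A) :
    comp n i (comp m k q) = comp (m * n) (m * i + k) q := by
  funext j
  simp only [comp]
  ring_nf

/-- The prefix of `merge p q` that is determined by a prefix `l₁` of `p` and a prefix `l₂` of `q`
that is not longer than `l₁`. -/
def mergeList [One A] (l₁ l₂ : List A) : List A :=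
  initSeg (merge (fun i => l₁.getD i 1) fun i => l₂.getD i 1) (2 * l₂.length)

theorem mergeList_initSeg [One A] (p q : ℕ → A) {m n : ℕ} (h : n ≤ m) :
    mergeList (initSeg p m) (initSeg q n) = initSeg (merge p q) (2 * n) := by
  rw [mergeList, length_initSeg]
  refine List.map_congr_left fun j hj => ?_
  rw [List.mem_range] at hj
  simp only [merge, List.getD_eq_getElem?_getD, getElem?_initSeg (show j / 2 < n by lia),
    getElem?_initSeg (show j / 2 < m by lia), Option.getD_some]

end Merge

section Entries

variable {A : Type} [Zero A] [One A] (Φ : ℕ → ℕ → ℕ) (admissible : ℕ → Prop)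

/-- The words that are seen in the prefix `l` of the input to be listed by the component number
`b` out of `a` of the name of the factor `i`, which is read off the input at the positions
`Φ i 0, Φ i 1, …`. -/
noncomputable def seenWords (a b i : ℕ) (l : List A) : List (List A) :=
  wrappedWords (subseqPrefix (fun j => Φ i (a * j + b)) l)

/-- It is seen in the prefix `l` of the input that `z` belongs to the graph of the characteristic
function of the domain of the notation of the product. -/
def IsDomEntry (z l : List A) : Prop :=
  (IsTupleWith admissible (fun i u => wordTuple [u, [1]] ∈ seenWords Φ 4 0 i l) (component z 0) ∧
      z = wordTuple [component z 0, [1]]) ∨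
    (¬ IsTupleWith admissible (fun i u => wordTuple [u, [0]] ∉ seenWords Φ 4 0 i l)
        (component z 0) ∧
      z = wordTuple [component z 0, [0]])

/-- It is seen in the prefix `l` of the input that `z` is a triple of the relation for the
intersections in the product. -/
def IsIntersectionEntry (z l : List A) : Prop :=
  TupleIntersection admissible (fun i u => wordTuple [u, [1]] ∈ seenWords Φ 4 0 i l)
      (fun i u v w => wordTuple [u, v, w] ∈ seenWords Φ 4 2 i l)
      (component z 0) (component z 1) (component z 2) ∧
    z = wordTuple [component z 0, component z 1, component z 2]

/-- It is seen in the prefix `l` of the input that `w` is a minimal cover of the product. -/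
def IsCoverEntry (w l : List A) : Prop :=
  (∀ v ∈ wrappedWords w, IsTupleWith admissible
      (fun i u => ∃ c ∈ seenWords Φ 2 1 i l, u ∈ wrappedWords c) v) ∧
    ∀ s ∈ ((wrappedWords w).map indexed).sections, ∃ i < l.length,
      ∃ c ∈ seenWords Φ 2 1 i l, ∀ u ∈ wrappedWords c, (u, i) ∈ s

/-- The name of a product that is computed from the input `p`. -/
noncomputable def prodName [Encodable A] (p : ℕ → A) : ℕ → A :=
  merge (merge (enumSeq (IsDomEntry Φ admissible) p) (enumSeq (IsIntersectionEntry Φ admissible) p))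
    (enumSeq (IsCoverEntry Φ admissible) p)

/-- The prefix of the name of a product that is determined by the prefix `l` of the input. -/
noncomputable def prodPrefix [Encodable A] (l : List A) : List A :=
  mergeList
    (mergeList (enumPrefix (IsDomEntry Φ admissible) l)
      (enumPrefix (IsIntersectionEntry Φ admissible) l))
    (enumPrefix (IsCoverEntry Φ admissible) l)

theorem prodPrefix_initSeg [Encodable A] (p : ℕ → A) (n : ℕ) :
    prodPrefix Φ admissible (initSeg p n) = initSeg (prodName Φ admissible p) (2 * n) := by
  rw [prodPrefix, enumPrefix_initSeg, enumPrefix_initSeg, enumPrefix_initSeg,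
    mergeList_initSeg _ _ le_rfl, mergeList_initSeg _ _ (by lia), prodName]

end Entries

namespace Verifies

variable {A : Type} [Zero A] [One A] {p : ℕ → A} {admissible : ℕ → Prop}
  {R R' : List A → ℕ → List A → Prop} {P P' : ℕ → List A → Prop}

theorem isTupleWith (h : ∀ i u, Verifies p (fun l => R l i u) (P i u)) (w : List A) :
    Verifies p (fun l => IsTupleWith admissible (R l) w) (IsTupleWith admissible P w) :=
  (const _).and ((const _).and (forall_lt fun i _ => h i _))

theorem not_isTupleWith (h : ∀ i u, Verifies p (fun l => ¬ R l i u) (¬ P i u)) (w : List A) :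
    Verifies p (fun l => ¬ IsTupleWith admissible (R l) w) (¬ IsTupleWith admissible P w) := by
  simp only [IsTupleWith, not_and_or, not_forall, exists_prop]
  exact (const _).or ((const _).or (exists_of_forall fun i => (const _).and (h i _)))

theorem tupleIntersection {D : List A → ℕ → List A → Prop} {D' : ℕ → List A → Prop}
    {T : List A → ℕ → List A → List A → List A → Prop}
    {T' : ℕ → List A → List A → List A → Prop}
    (hD : ∀ i u, Verifies p (fun l => D l i u) (D' i u))
    (hT : ∀ i u v w, Verifies p (fun l => T l i u v w) (T' i u v w)) (u v w : List A) :
    Verifies p (fun l => TupleIntersection admissible (D l) (T l) u v w)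
      (TupleIntersection admissible D' T' u v w) :=
  (isTupleWith hD u).and ((isTupleWith hD v).and ((const _).and (isTupleWith (fun i x =>
    ((const _).and ((const _).and (hT i _ _ x))).or (const _)) w)))

end Verifies

section MemProdName

variable {A : Type} [Zero A] [One A] [NeZero (1 : A)] {C : ℕ → CompactPair.{u} A}
  {admissible : ℕ → Prop} {Y : CompactPair.{u} A}
  {proj : Y.space.carrier → ∀ i, (C i).space.carrier} {Φ : ℕ → ℕ → ℕ} {p : ℕ → A}
  (hΦ : ∀ i, StrictMono (Φ i))

include hΦ in
theorem verifies_mem_seenWords {a : ℕ} (ha : 0 < a) (b i : ℕ) (z : List A) :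
    Verifies p (fun l => z ∈ seenWords Φ a b i l) (Occurs z (comp a b (p ∘ Φ i))) := by
  simp only [seenWords, mem_wrappedWords]
  refine verifies_occursW_subseqPrefix (fun j k hjk => hΦ i ?_) p z
  exact Nat.add_lt_add_right (Nat.mul_lt_mul_of_pos_left hjk ha) b

variable (hY : IsProduct C admissible Y proj) (hp : ∀ i, C i ∈ kappaTildeDelta (p ∘ Φ i))

section Domain

include hΦ hp

theorem verifies_wordTuple_one_mem_seenWords (i : ℕ) (u : List A) :
    Verifies p (fun l => wordTuple [u, [1]] ∈ seenWords Φ 4 0 i l)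
      (u ∈ (C i).space.ν.Dom) := by
  refine (verifies_mem_seenWords hΦ (by simp) 0 i _).congr ?_
  rw [← occurs_wordTuple_one_iff (hp i).1, comp_comp]

theorem verifies_wordTuple_zero_mem_seenWords (i : ℕ) (u : List A) :
    Verifies p (fun l => wordTuple [u, [0]] ∈ seenWords Φ 4 0 i l)
      (u ∉ (C i).space.ν.Dom) := by
  refine (verifies_mem_seenWords hΦ (by simp) 0 i _).congr ?_
  rw [← occurs_wordTuple_zero_iff (hp i).1, comp_comp]

include hY

theorem IsProduct.occurs_enumSeq_isDomEntry [Encodable A] (z : List A) :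
    Occurs z (enumSeq (IsDomEntry Φ admissible) p) ↔
      ∃ w, (w ∈ Y.space.ν.Dom ∧ z = wordTuple [w, [1]]) ∨
        (w ∉ Y.space.ν.Dom ∧ z = wordTuple [w, [0]]) := by
  refine (occurs_enumSeq (P := fun z => (component z 0 ∈ Y.space.ν.Dom ∧
    z = wordTuple [component z 0, [1]]) ∨ (component z 0 ∉ Y.space.ν.Dom ∧
    z = wordTuple [component z 0, [0]])) ?_).trans ⟨fun h => ⟨_, h⟩, ?_⟩
  · simp only [hY.mem_dom_iff]
    refine .or (.and (.isTupleWith (verifies_wordTuple_one_mem_seenWords hΦ hp) _) (.const _))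
      (.and (.not_isTupleWith (fun i u => ?_) _) (.const _))
    simpa only [not_not] using verifies_wordTuple_zero_mem_seenWords hΦ hp i u
  · rintro ⟨w, ⟨hw, rfl⟩ | ⟨hw, rfl⟩⟩ <;> simp [component_wordTuple, hw]

theorem IsProduct.exists_isIntersectionRel [Encodable A] : ∃ T, IsIntersectionRel Y.space T ∧
    ∀ z, Occurs z (enumSeq (IsIntersectionEntry Φ admissible) p) ↔
      ∃ u v w, T u v w ∧ z = wordTuple [u, v, w] := by
  choose T hT hocc using fun i => (mem_Delta_iff.1 (hp i).1).2
  refine ⟨_, hY.isIntersectionRel hT, fun z => ?_⟩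
  refine (occurs_enumSeq (P := fun z => TupleIntersection admissible
    (fun i u => u ∈ (C i).space.ν.Dom) T (component z 0) (component z 1) (component z 2) ∧
    z = wordTuple [component z 0, component z 1, component z 2]) ?_).trans
    ⟨fun h => ⟨_, _, _, h⟩, ?_⟩
  · refine .and (.tupleIntersection (verifies_wordTuple_one_mem_seenWords hΦ hp)
      (fun i u v w => ?_) _ _ _) (.const _)
    refine (verifies_mem_seenWords hΦ (by simp) 2 i _).congr ?_
    have hi := hocc i (wordTuple [u, v, w])
    rw [comp_comp] at hi
    exact hi.trans (by simp [wordTuple_injective.eq_iff])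
  · rintro ⟨u, v, w, h, rfl⟩
    simpa [component_wordTuple] using h

end Domain

section Covers

include hΦ hp

theorem verifies_exists_mem_wrappedWords (i : ℕ) (u : List A) :
    Verifies p (fun l => ∃ c ∈ seenWords Φ 2 1 i l, u ∈ wrappedWords c)
      (∃ x ∈ (C i).set, InBase (C i).space u x) :=
  (Verifies.exists_of_forall fun c =>
    (verifies_mem_seenWords hΦ (by simp) 1 i c).and (.const _)).congr
    (exists_occurs_mem_iff (hp i).2 (C i).isCompact u)

theorem verifies_exists_forall_wrappedWords (s : List (List A × ℕ)) :
    Verifies p (fun l => ∃ i < l.length, ∃ c ∈ seenWords Φ 2 1 i l,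
        ∀ u ∈ wrappedWords c, (u, i) ∈ s)
      (∃ i, ∀ x ∈ (C i).set, ∃ u, (u, i) ∈ s ∧ InBase (C i).space u x) :=
  .exists_lt_length fun i => (Verifies.exists_of_forall fun c =>
    (verifies_mem_seenWords hΦ (by simp) 1 i c).and (.const _)).congr
    (exists_occurs_subset_iff (hp i).2
      (s.finite_toSet.preimage (Prod.mk_left_injective i).injOn))

include hY

theorem IsProduct.occurs_enumSeq_isCoverEntry [Encodable A] (w : List A) :
    Occurs w (enumSeq (IsCoverEntry Φ admissible) p) ↔
      (∀ v ∈ wrappedWords w, ∃ y ∈ Y.set, InBase Y.space v y) ∧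
        ∀ y ∈ Y.set, ∃ v ∈ wrappedWords w, InBase Y.space v y := by
  simp only [hY.exists_mem_inBase_iff]
  refine occurs_enumSeq (P := fun w => _) (Verifies.congr (.and
    (.forall_mem_list fun v _ => .isTupleWith (verifies_exists_mem_wrappedWords hΦ hp) v)
    (.forall_mem_list fun s _ => verifies_exists_forall_wrappedWords hΦ hp s)) ?_)
  exact and_congr_right fun h => (hY.cover_iff fun v hv => ⟨_, h v hv⟩).symm

theorem IsProduct.mem_prodName [Encodable A] : Y ∈ kappaTildeDelta (prodName Φ admissible p) := by
  refine ⟨mem_Delta_iff.2 ?_, mem_kappaTilde_iff.2 ?_⟩ <;>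
    simp only [prodName, comp_merge_zero, comp_merge_one]
  · exact ⟨hY.occurs_enumSeq_isDomEntry hΦ hp, hY.exists_isIntersectionRel hΦ hp⟩
  · exact hY.occurs_enumSeq_isCoverEntry hΦ hp

end Covers

end MemProdName

/-! ## Primitive recursiveness of the name of a product -/

section Quantifiers

variable {α β : Type*} [Primcodable α] [Primcodable β] {P : α → β → Prop} {f : α → List β}

theorem primrecPred_exists_mem (hf : Primrec f) (hP : PrimrecRel P) :
    PrimrecPred fun a => ∃ b ∈ f a, P a b :=
  hP.swap.exists_mem_list.comp hf Primrec.id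

theorem primrecPred_forall_mem (hf : Primrec f) (hP : PrimrecRel P) :
    PrimrecPred fun a => ∀ b ∈ f a, P a b :=
  hP.swap.forall_mem_list.comp hf Primrec.id

variable {Q : α → ℕ → Prop} {g : α → ℕ}

theorem primrecPred_exists_lt (hg : Primrec g) (hQ : PrimrecRel Q) :
    PrimrecPred fun a => ∃ i < g a, Q a i :=
  (primrecPred_exists_mem (Primrec.list_range.comp hg) hQ).of_eq fun a => by simp

theorem primrecPred_forall_lt (hg : Primrec g) (hQ : PrimrecRel Q) :
    PrimrecPred fun a => ∀ i < g a, Q a i :=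
  (primrecPred_forall_mem (Primrec.list_range.comp hg) hQ).of_eq fun a => by simp

theorem primrecRel_mem : PrimrecRel fun (b : β) (l : List β) => b ∈ l :=
  (primrecPred_exists_mem (f := Prod.snd) (P := fun (x : β × List β) b => b = x.1) Primrec.snd
    (Primrec.eq.comp Primrec.snd (Primrec.fst.comp Primrec.fst))).of_eq fun x => by simp

theorem primrec_sections : Primrec (List.sections : List (List β) → List (List β)) := by
  have primrec_foldr : Primrec fun L : List (List β) =>
      L.foldr (fun l acc => acc.flatMap fun s => l.map fun a => a :: s) [[]] := by
    have primrec_step : Primrec₂ fun (_ : List (List β)) (x : List β × List (List β)) =>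
        x.2.flatMap fun s => x.1.map fun a => a :: s := by
      refine Primrec.list_flatMap (Primrec.snd.comp Primrec.snd) ?_
      refine Primrec.list_map (Primrec.fst.comp (Primrec.snd.comp Primrec.fst)) ?_
      exact Primrec.list_cons.comp Primrec.snd (Primrec.snd.comp Primrec.fst)
    exact Primrec.list_foldr Primrec.id (Primrec.const _) primrec_step
  refine primrec_foldr.of_eq fun L => ?_
  induction L with
  | nil => rfl
  | cons l L ih => rw [List.foldr_cons, ih, List.sections]

end Quantifiers

section WordTuples

variable {A : Type} [Primcodable A] [Zero A] [One A]

theorem primrec_iota : Primrec (iota : List A → List A) :=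
  Primrec.list_append.comp (Primrec.list_append.comp (Primrec.const _)
    (Primrec.list_flatMap Primrec.id
      (Primrec.list_cons.comp Primrec.snd (Primrec.const [0])))) (Primrec.const _)

theorem primrec_wordTuple : Primrec (wordTuple : List (List A) → List A) :=
  Primrec.list_flatMap Primrec.id (primrec_iota.comp Primrec.snd)

theorem primrec_wordTuple_pair {α : Type*} [Primcodable α] {f g : α → List A}
    (hf : Primrec f) (hg : Primrec g) : Primrec fun a => wordTuple [f a, g a] :=
  primrec_wordTuple.comp (Primrec.list_cons.comp hf (Primrec.list_cons.comp hg (Primrec.const [])))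

theorem primrec_wordTuple_triple {α : Type*} [Primcodable α] {f g h : α → List A}
    (hf : Primrec f) (hg : Primrec g) (hh : Primrec h) :
    Primrec fun a => wordTuple [f a, g a, h a] :=
  primrec_wordTuple.comp (Primrec.list_cons.comp hf
    (Primrec.list_cons.comp hg (Primrec.list_cons.comp hh (Primrec.const []))))

theorem primrec_block : Primrec (block : Option (List A) → List A) :=
  (Primrec.option_casesOn Primrec.id (Primrec.const [1])
    (primrec_iota.comp₂ Primrec₂.right)).of_eq fun o => by cases o <;> rfl

theorem primrecRel_iota_prefix : PrimrecRel fun v x : List A => iota v <+: x :=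
  (PrimrecRel.of_eq · fun _ _ => List.prefix_iff_eq_take.symm) <|
    Primrec.eq.comp (primrec_iota.comp Primrec.fst) (Primrec.list_take.comp
      (Primrec.list_length.comp (primrec_iota.comp Primrec.fst)) Primrec.snd)

end WordTuples

section WrappedWords

variable {A : Type} [Zero A]

theorem getElem?_flatMap_append (v s : List A) {t : ℕ} (ht : t < v.length) :
    (v.flatMap (fun a => [a, 0]) ++ s)[2 * t]? = v[t]? := by
  induction v generalizing t with
  | nil => simp at ht
  | cons a v ih =>
    cases t with
    | zero => simp
    | succ t =>
      have := ih (t := t) (by simpa using ht)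
      simpa [show 2 * (t + 1) = 2 * t + 1 + 1 by lia] using this

variable [One A]

theorem map_getD_iota_append (v s : List A) :
    ((List.range v.length).map fun t => (iota v ++ s).getD (3 + 2 * t) 0) = v := by
  refine List.ext_getElem (by simp) fun t _ ht => ?_
  have := getElem?_flatMap_append v ([1, 1] ++ s) ht
  rw [List.getElem?_eq_getElem ht] at this
  simp only [List.getElem_map, List.getElem_range, List.getD_eq_getElem?_getD,
    show 3 + 2 * t = 2 * t + 1 + 1 + 1 by lia]
  simpa [iota] using congrArg (Option.getD · 0) this

variable [NeZero (1 : A)]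

open Classical in
/-- A word `v` can be read off every word with the prefix `ι(v)` once its length is known. -/
theorem headWord_eq_head?_filter (x : List A) :
    headWord x = (((List.range (x.length + 1)).map fun k =>
      (List.range k).map fun t => x.getD (3 + 2 * t) 0).filter fun v => iota v <+: x).head? := by
  generalize hL : List.filter _ _ = L
  have mem_iff (v : List A) : v ∈ L ↔ iota v <+: x := by
    simp only [← hL, List.mem_filter, List.mem_map, List.mem_range, decide_eq_true_eq,
      and_iff_right_iff_imp]
    rintro ⟨s, rfl⟩
    refine ⟨v.length, ?_, map_getD_iota_append v s⟩
    rw [List.length_append, length_iota]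
    lia
  cases L with
  | nil =>
    exact Option.eq_none_iff_forall_ne_some.2 fun v hv =>
      List.not_mem_nil ((mem_iff v).2 (headWord_eq_some_iff.1 hv))
  | cons v L => exact headWord_eq_some_iff.2 ((mem_iff v).1 List.mem_cons_self)

variable [Primcodable A]

theorem primrec_headWord : Primrec (headWord : List A → Option (List A)) := by
  classical
  have primrec_candidates : Primrec fun x : List A => (List.range (x.length + 1)).map fun k =>
      (List.range k).map fun t => x.getD (3 + 2 * t) 0 := by
    refine Primrec.list_map (Primrec.list_range.comp (Primrec.succ.comp Primrec.list_length)) ?_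
    refine Primrec.list_map (Primrec.list_range.comp Primrec.snd) ?_
    exact (Primrec.list_getD 0).comp (Primrec.fst.comp Primrec.fst)
      (Primrec.nat_add.comp (Primrec.const 3) (Primrec.nat_mul.comp (Primrec.const 2) Primrec.snd))
  exact (Primrec.list_head?.comp (primrecRel_iota_prefix.listFilter.comp primrec_candidates
    Primrec.id)).of_eq fun x => (headWord_eq_head?_filter x).symm

theorem primrec_wrappedWords : Primrec (wrappedWords : List A → List (List A)) := by
  have primrec_drop : Primrec fun w : List A =>
      (List.range (w.length + 1)).filterMap fun i => headWord (w.drop i) :=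
    Primrec.listFilterMap (Primrec.list_range.comp (Primrec.succ.comp Primrec.list_length))
      (primrec_headWord.comp (Primrec.list_drop.comp Primrec.snd Primrec.fst))
  refine primrec_drop.of_eq fun w => ?_
  have htails : (List.range (w.length + 1)).map (w.drop ·) = w.tails :=
    List.ext_getElem (by simp) fun i _ _ => by simp
  rw [wrappedWords, ← htails, List.filterMap_map]
  rfl

theorem primrec_length_wrappedWords : Primrec fun w : List A => (wrappedWords w).length :=
  Primrec.list_length.comp primrec_wrappedWords

theorem primrec_component : Primrec₂ (component : List A → ℕ → List A) :=
  (Primrec.list_getD []).comp (primrec_wrappedWords.comp Primrec.fst) Primrec.snd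

theorem primrec_indexed : Primrec (indexed : List A → List (List A × ℕ)) :=
  Primrec.list_map (Primrec.list_range.comp primrec_length_wrappedWords)
    (Primrec.pair primrec_component Primrec.snd)

variable {α : Type*} [Primcodable α] {admissible : ℕ → Prop} (hadm : PrimrecPred admissible)
include hadm

theorem primrecPred_isTupleWith {P : α → ℕ → List A → Prop}
    (hP : PrimrecPred fun x : (α × ℕ) × List A => P x.1.1 x.1.2 x.2) {w : α → List A}
    (hw : Primrec w) : PrimrecPred fun a => IsTupleWith admissible (P a) (w a) :=
  (Primrec.eq.comp (primrec_wordTuple.comp (primrec_wrappedWords.comp hw)) hw).and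
    ((hadm.comp (primrec_length_wrappedWords.comp hw)).and
      (primrecPred_forall_lt (primrec_length_wrappedWords.comp hw)
        (hP.comp (Primrec.pair Primrec.id
          (primrec_component.comp (hw.comp Primrec.fst) Primrec.snd)))))

theorem primrecPred_tupleIntersection {D : α → ℕ → List A → Prop}
    {T : α → ℕ → List A → List A → List A → Prop}
    (hD : PrimrecPred fun x : (α × ℕ) × List A => D x.1.1 x.1.2 x.2)
    (hT : PrimrecPred fun x : (α × ℕ) × List A × List A × List A =>
      T x.1.1 x.1.2 x.2.1 x.2.2.1 x.2.2.2)
    {u v w : α → List A} (hu : Primrec u) (hv : Primrec v) (hw : Primrec w) :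
    PrimrecPred fun a => TupleIntersection admissible (D a) (T a) (u a) (v a) (w a) := by
  have i : Primrec fun x : (α × ℕ) × List A => x.1.2 := Primrec.snd.comp Primrec.fst
  have hu' : Primrec fun x : (α × ℕ) × List A => u x.1.1 :=
    hu.comp (Primrec.fst.comp Primrec.fst)
  have hv' : Primrec fun x : (α × ℕ) × List A => v x.1.1 :=
    hv.comp (Primrec.fst.comp Primrec.fst)
  refine (primrecPred_isTupleWith hadm hD hu).and ((primrecPred_isTupleWith hadm hD hv).and
    ((Primrec.eq.comp (primrec_length_wrappedWords.comp hw) (Primrec.nat_max.comp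
      (primrec_length_wrappedWords.comp hu) (primrec_length_wrappedWords.comp hv))).and
      (primrecPred_isTupleWith hadm ?_ hw)))
  refine PrimrecPred.or ?_ (PrimrecPred.or ?_ ?_)
  · refine (Primrec.nat_lt.comp i (primrec_length_wrappedWords.comp hu')).and
      ((Primrec.nat_lt.comp i (primrec_length_wrappedWords.comp hv')).and ?_)
    exact hT.comp (Primrec.pair Primrec.fst (Primrec.pair (primrec_component.comp hu' i)
      (Primrec.pair (primrec_component.comp hv' i) Primrec.snd)))
  · exact (Primrec.nat_le.comp (primrec_length_wrappedWords.comp hv') i).and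
      (Primrec.eq.comp Primrec.snd (primrec_component.comp hu' i))
  · exact (Primrec.nat_le.comp (primrec_length_wrappedWords.comp hu') i).and
      (Primrec.eq.comp Primrec.snd (primrec_component.comp hv' i))

end WrappedWords

section Prefixes

variable {A : Type} [Primcodable A]

theorem primrec_initSeg {α : Type*} [Primcodable α] {p : α → ℕ → A} (hp : Primrec₂ p)
    {n : α → ℕ} (hn : Primrec n) : Primrec fun a => initSeg (p a) (n a) :=
  Primrec.list_map (Primrec.list_range.comp hn) hp

theorem primrec_listed {R : List A → List A → Prop} (hR : PrimrecRel R) : Primrec (listed R) := by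
  classical
  have primrec_bind : Primrec fun l : List A =>
      (Encodable.decode (α := List A) l.length.unpair.1).bind fun w =>
        if R w l then some w else none :=
    Primrec.option_bind (Primrec.decode.comp
      (Primrec.fst.comp (Primrec.unpair.comp Primrec.list_length)))
      (Primrec.ite (hR.comp Primrec.snd Primrec.fst) (Primrec.option_some.comp Primrec.snd)
        (Primrec.const none))
  refine primrec_bind.of_eq fun l => ?_
  rw [listed]
  cases Encodable.decode (α := List A) l.length.unpair.1 <;> simp [Option.filter]

variable [One A]

theorem primrec_mergeList : Primrec₂ (mergeList : List A → List A → List A) := by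
  have primrec_half : Primrec fun x : (List A × List A) × ℕ => x.2 / 2 :=
    Primrec.nat_div.comp Primrec.snd (Primrec.const 2)
  refine primrec_initSeg (α := List A × List A) (p := fun x => merge (fun i => x.1.getD i 1)
    fun i => x.2.getD i 1) (Primrec.ite (Primrec.eq.comp (Primrec.nat_mod.comp Primrec.snd
      (Primrec.const 2)) (Primrec.const 0)) ?_ ?_) (Primrec.nat_mul.comp (Primrec.const 2)
        (Primrec.list_length.comp Primrec.snd))
  · exact (Primrec.list_getD 1).comp (Primrec.fst.comp Primrec.fst) primrec_half
  · exact (Primrec.list_getD 1).comp (Primrec.snd.comp Primrec.fst) primrec_half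

variable [Zero A]

theorem primrec_blocks {α : Type*} [Primcodable α] {E : α → ℕ → Option (List A)} (hE : Primrec₂ E)
    {m : α → ℕ} (hm : Primrec m) : Primrec fun a => blocks (E a) (m a) :=
  Primrec.list_flatMap (Primrec.list_map (Primrec.list_range.comp hm) hE)
    (primrec_block.comp Primrec.snd)

theorem primrec_enumPrefix {R : List A → List A → Prop} (hR : PrimrecRel R) :
    Primrec (enumPrefix R) :=
  Primrec.list_take.comp Primrec.list_length (primrec_blocks
    ((primrec_listed hR).comp (Primrec.list_take.comp Primrec.snd Primrec.fst)).to₂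
    Primrec.list_length)

end Prefixes

section Entries

variable {A : Type} [Primcodable A] [Zero A] [One A] [NeZero (1 : A)] {Φ : ℕ → ℕ → ℕ}
  {admissible : ℕ → Prop}

section SeenWords

variable (hΦ : Primrec₂ Φ) {α : Type*} [Primcodable α] {i : α → ℕ} {l : α → List A}
include hΦ

theorem primrec_seenWords (a b : ℕ) (hi : Primrec i) (hl : Primrec l) :
    Primrec fun x => seenWords Φ a b (i x) (l x) := by
  refine primrec_wrappedWords.comp (Primrec.listFilterMap
    (Primrec.list_range.comp (Primrec.list_length.comp hl)) ?_)
  refine Primrec.list_getElem?.comp (hl.comp Primrec.fst) ?_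
  exact hΦ.comp (hi.comp Primrec.fst) (Primrec.nat_add.comp
    (Primrec.nat_mul.comp (Primrec.const a) Primrec.snd) (Primrec.const b))

theorem primrecPred_mem_seenWords (a b : ℕ) {z : α → List A} (hz : Primrec z) (hi : Primrec i)
    (hl : Primrec l) : PrimrecPred fun x => z x ∈ seenWords Φ a b (i x) (l x) :=
  primrecRel_mem.comp hz (primrec_seenWords hΦ a b hi hl)

end SeenWords

variable (hΦ : Primrec₂ Φ) (hadm : PrimrecPred admissible)
include hΦ hadm

theorem primrecRel_isDomEntry : PrimrecRel (IsDomEntry (A := A) Φ admissible) := by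
  have primrec_head : Primrec fun x : List A × List A => component x.1 0 :=
    primrec_component.comp Primrec.fst (Primrec.const 0)
  have primrecPred_seen (a : A) : PrimrecPred fun x : ((List A × List A) × ℕ) × List A =>
      wordTuple [x.2, [a]] ∈ seenWords Φ 4 0 x.1.2 x.1.1.2 :=
    primrecPred_mem_seenWords hΦ 4 0 (primrec_wordTuple_pair Primrec.snd (Primrec.const _))
      (Primrec.snd.comp Primrec.fst) (Primrec.snd.comp (Primrec.fst.comp Primrec.fst))
  have primrecPred_eq (a : A) : PrimrecPred fun x : List A × List A =>
      x.1 = wordTuple [component x.1 0, [a]] :=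
    Primrec.eq.comp Primrec.fst (primrec_wordTuple_pair primrec_head (Primrec.const _))
  exact ((primrecPred_isTupleWith hadm (primrecPred_seen 1) primrec_head).and
    (primrecPred_eq 1)).or ((primrecPred_isTupleWith hadm (primrecPred_seen 0).not
      primrec_head).not.and (primrecPred_eq 0))

theorem primrecRel_isIntersectionEntry :
    PrimrecRel (IsIntersectionEntry (A := A) Φ admissible) := by
  have primrec_fst_component (i : ℕ) : Primrec fun x : List A × List A => component x.1 i :=
    primrec_component.comp Primrec.fst (Primrec.const i)
  refine (primrecPred_tupleIntersection hadm ?_ ?_ (primrec_fst_component 0)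
    (primrec_fst_component 1) (primrec_fst_component 2)).and (Primrec.eq.comp Primrec.fst
      (primrec_wordTuple_triple (primrec_fst_component 0) (primrec_fst_component 1)
        (primrec_fst_component 2)))
  · exact primrecPred_mem_seenWords hΦ 4 0
      (primrec_wordTuple_pair Primrec.snd (Primrec.const _))
      (Primrec.snd.comp Primrec.fst) (Primrec.snd.comp (Primrec.fst.comp Primrec.fst))
  · exact primrecPred_mem_seenWords hΦ 4 2
      (primrec_wordTuple_triple (Primrec.fst.comp Primrec.snd)
        (Primrec.fst.comp (Primrec.snd.comp Primrec.snd))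
        (Primrec.snd.comp (Primrec.snd.comp Primrec.snd)))
      (Primrec.snd.comp Primrec.fst) (Primrec.snd.comp (Primrec.fst.comp Primrec.fst))

theorem primrecRel_isCoverEntry : PrimrecRel (IsCoverEntry (A := A) Φ admissible) := by
  have primrecPred_meets : PrimrecPred fun x : (((List A × List A) × List A) × ℕ) × List A =>
      ∃ c ∈ seenWords Φ 2 1 x.1.2 x.1.1.1.2, x.2 ∈ wrappedWords c :=
    primrecPred_exists_mem
      (primrec_seenWords hΦ 2 1 (Primrec.snd.comp Primrec.fst)
        (Primrec.snd.comp (Primrec.fst.comp (Primrec.fst.comp Primrec.fst))))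
      (primrecRel_mem.comp (Primrec.snd.comp Primrec.fst)
        (primrec_wrappedWords.comp Primrec.snd))
  have primrecRel_meets : PrimrecRel fun (x : List A × List A) v => IsTupleWith admissible
      (fun i u => ∃ c ∈ seenWords Φ 2 1 i x.2, u ∈ wrappedWords c) v :=
    primrecPred_isTupleWith (P := fun (x : (List A × List A) × List A) i u =>
      ∃ c ∈ seenWords Φ 2 1 i x.1.2, u ∈ wrappedWords c) hadm primrecPred_meets Primrec.snd
  have primrecRel_covers : PrimrecRel fun (x : List A × List A) (s : List (List A × ℕ)) =>
      ∃ i < x.2.length, ∃ c ∈ seenWords Φ 2 1 i x.2, ∀ u ∈ wrappedWords c, (u, i) ∈ s :=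
    primrecPred_exists_lt (Primrec.list_length.comp (Primrec.snd.comp Primrec.fst))
      (primrecPred_exists_mem (primrec_seenWords hΦ 2 1 Primrec.snd
        (Primrec.snd.comp (Primrec.fst.comp Primrec.fst)))
        (primrecPred_forall_mem (primrec_wrappedWords.comp Primrec.snd)
          (primrecRel_mem.comp
            (Primrec.pair Primrec.snd (Primrec.snd.comp (Primrec.fst.comp Primrec.fst)))
            (Primrec.snd.comp (Primrec.fst.comp (Primrec.fst.comp Primrec.fst))))))
  exact (primrecPred_forall_mem (primrec_wrappedWords.comp Primrec.fst) primrecRel_meets).and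
    (primrecPred_forall_mem (primrec_sections.comp (Primrec.list_map
      (primrec_wrappedWords.comp Primrec.fst) (primrec_indexed.comp Primrec.snd).to₂))
      primrecRel_covers)

theorem primrec_prodPrefix : Primrec (prodPrefix (A := A) Φ admissible) :=
  primrec_mergeList.comp
    (primrec_mergeList.comp (primrec_enumPrefix (primrecRel_isDomEntry hΦ hadm))
      (primrec_enumPrefix (primrecRel_isIntersectionEntry hΦ hadm)))
    (primrec_enumPrefix (primrecRel_isCoverEntry hΦ hadm))

end Entries

/-! ## Binary and countable products -/

section Realizers

variable {A : Type} [Zero A] [One A] [NeZero (1 : A)] [Finite A] [Primcodable A] {M : Type u}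
  {M' : Type v} {γ : MultiRep A M} {γ' : MultiRep A M'} {f : M →. M'} {Φ : ℕ → ℕ → ℕ}
  {admissible : ℕ → Prop}

theorem computableWrt_of_prodName (hΦ : Primrec₂ Φ) (hadm : PrimrecPred admissible)
    (h : ∀ p x, x ∈ γ p → ∀ y ∈ f x, y ∈ γ' (prodName Φ admissible p)) :
    ComputableWrt γ γ' f :=
  computableWrt_of_initSeg (primrec_prodPrefix hΦ hadm).to_comp fun p x hx y hy =>
    ⟨_, h p x hx y hy, (2 * ·), Filter.tendsto_id.const_mul_atTop' two_pos,
      prodPrefix_initSeg Φ admissible p⟩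

end Realizers

section Products

variable {A : Type} [Zero A] [One A] [NeZero (1 : A)]

/-- The pairs of a binary product as a sequence; the second one is repeated. -/
def pairSeq (C : CompactPair.{u} A × CompactPair.{u} A) : ℕ → CompactPair.{u} A
  | 0 => C.1
  | _ + 1 => C.2

/-- The components of a point of a binary product, along `pairSeq`. -/
def pairProj (C : CompactPair.{u} A × CompactPair.{u} A)
    (y : (CompactPair.prod C).space.carrier) : ∀ i, (pairSeq C i).space.carrier
  | 0 => y.1
  | _ + 1 => y.2

/-- The positions in `⟨p₁, p₂⟩` of the symbols of the components, along `pairSeq`. -/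
def pairIndex (i j : ℕ) : ℕ := 2 * j + if i = 0 then 0 else 1

theorem isProduct_pair (C : CompactPair.{u} A × CompactPair.{u} A) :
    IsProduct (pairSeq C) (· = 2) (CompactPair.prod C) (pairProj C) where
  mem_dom_iff w := by
    rw [isTupleWith_iff_exists]
    constructor
    · rintro ⟨u₁, u₂, rfl, h₁, h₂⟩
      refine ⟨[u₁, u₂], rfl, rfl, fun i hi => ?_⟩
      match i, hi with
      | 0, _ => exact h₁
      | 1, _ => exact h₂
    · rintro ⟨us, hlen, rfl, h⟩
      obtain ⟨u₁, u₂, rfl⟩ := List.length_eq_two.1 hlen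
      exact ⟨u₁, u₂, rfl, h 0 (by simp), h 1 (by simp)⟩
  inBase_iff w y := by
    rw [isTupleWith_iff_exists]
    constructor
    · rintro ⟨S, hS, hy⟩
      obtain ⟨u₁, u₂, rfl, U, hU, V, hV, rfl⟩ := mem_prodNu.1 hS
      refine ⟨[u₁, u₂], rfl, rfl, fun i hi => ?_⟩
      match i, hi with
      | 0, _ => exact ⟨U, hU, hy.1⟩
      | 1, _ => exact ⟨V, hV, hy.2⟩
    · rintro ⟨us, hlen, rfl, h⟩
      obtain ⟨u₁, u₂, rfl⟩ := List.length_eq_two.1 hlen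
      obtain ⟨U, hU, hyU⟩ := h 0 (by simp)
      obtain ⟨V, hV, hyV⟩ := h 1 (by simp)
      exact ⟨U ×ˢ V, mem_prodNu.2 ⟨u₁, u₂, rfl, U, hU, V, hV, rfl⟩, hyU, hyV⟩
  proj_mem
    | _, hy, 0 => hy.1
    | _, hy, _ + 1 => hy.2
  exists_proj_eq x hx := by
    refine ⟨(x 0, x 1), ⟨hx 0, hx 1⟩, ?_⟩
    rintro _ rfl i hi
    match i, hi with
    | 0, _ => rfl
    | 1, _ => rfl
  nonempty
    | _, rfl, h, 0 => h 0 two_pos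
    | _, rfl, h, _ + 1 => h 1 one_lt_two

theorem isProduct_pi {C : ℕ → CompactPair.{u} A} (hC : ∀ i, (C i).set.Nonempty) :
    IsProduct C (· ≠ 0) (CompactPair.pi C) (fun y => y) where
  mem_dom_iff w := by
    simp only [isTupleWith_iff_exists, ne_eq, List.length_eq_zero_iff]
    rfl
  inBase_iff w y := by
    simp only [isTupleWith_iff_exists, ne_eq, List.length_eq_zero_iff]
    constructor
    · rintro ⟨S, hS, hy⟩
      obtain ⟨us, hne, rfl, U, hU, rfl⟩ := mem_piNu.1 hS
      exact ⟨us, hne, rfl, fun i hi => ⟨U i, hU i hi, hy i hi⟩⟩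
    · rintro ⟨us, hne, rfl, h⟩
      have hdom : (piNu (fun i => (C i).space) (wordTuple us)).Dom :=
        ⟨us, hne, rfl, fun i hi => (h i hi).mem_dom⟩
      exact ⟨_, Part.get_mem hdom, us, hne, rfl, h⟩
  proj_mem y hy i := hy i trivial
  exists_proj_eq x hx := ⟨x, fun i _ => hx i, fun _ _ _ _ => rfl⟩
  nonempty _ _ _ := hC

theorem strictMono_pairIndex (i : ℕ) : StrictMono (pairIndex i) := by
  intro j k h
  simp only [pairIndex]
  lia

theorem strictMono_cantorPair (i : ℕ) : StrictMono (cantorPair i) := by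
  refine strictMono_nat_of_lt_succ fun j => Nat.add_lt_add_of_le_of_lt ?_ j.lt_succ_self
  gcongr <;> exact j.le_succ

theorem primrec_pairIndex : Primrec₂ pairIndex :=
  Primrec.nat_add.comp (Primrec.nat_mul.comp (Primrec.const 2) Primrec.snd)
    (Primrec.ite (Primrec.eq.comp Primrec.fst (Primrec.const 0)) (Primrec.const 0)
      (Primrec.const 1))

theorem primrec_cantorPair : Primrec₂ cantorPair := by
  have primrec_add : Primrec fun x : ℕ × ℕ => x.1 + x.2 := Primrec.nat_add
  exact Primrec.nat_add.comp (Primrec.nat_div.comp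
    (Primrec.nat_mul.comp primrec_add (Primrec.succ.comp primrec_add)) (Primrec.const 2))
    Primrec.snd

theorem primrecPred_eq_two : PrimrecPred fun n : ℕ => n = 2 :=
  Primrec.eq.comp Primrec.id (Primrec.const 2)

theorem prod_mem_prodName [Encodable A] {C : CompactPair.{u} A × CompactPair.{u} A} {p : ℕ → A}
    (h₁ : C.1 ∈ kappaTildeDelta (comp 2 0 p)) (h₂ : C.2 ∈ kappaTildeDelta (comp 2 1 p)) :
    CompactPair.prod C ∈ kappaTildeDelta (prodName pairIndex (· = 2) p) :=
  (isProduct_pair C).mem_prodName strictMono_pairIndex fun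
    | 0 => h₁
    | _ + 1 => h₂

variable [Finite A] [Primcodable A]

theorem computableWrt_prod :
    ComputableWrt (MultiRep.pair kappaTildeDelta kappaTildeDelta) kappaTildeDelta
      (CompactPair.prod.{u} (A := A) :
        CompactPair.{u} A × CompactPair.{u} A →. CompactPair.{u} A) :=
  computableWrt_of_prodName primrec_pairIndex primrecPred_eq_two fun p C hC y hy => by
    rw [PFun.coe_val, Part.mem_some_iff] at hy
    exact hy ▸ prod_mem_prodName hC.1 hC.2

theorem computableWrt_piNonempty :
    ComputableWrt (MultiRep.seq kappaTildeDelta) kappaTildeDelta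
      (CompactPair.piNonempty.{u} (A := A)) :=
  computableWrt_of_prodName primrec_cantorPair
    (Primrec.eq.comp Primrec.id (Primrec.const 0)).not fun p C hC y hy => by
      obtain ⟨hne, rfl⟩ := hy
      exact (isProduct_pi hne).mem_prodName strictMono_cantorPair hC

end Products

/-! ## Finite products -/

section FiniteProducts

variable {A : Type}

section Components

variable [One A]

/-- The first `L` symbols of the component `i` of `⟨p₀, …, pₙ₋₁⟩`, computed from a prefix of
`1ⁿ 0 ⟨p₀, …, pₙ₋₁⟩`. -/
def compList (n L : ℕ) (l : List A) (i : ℕ) : List A :=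
  initSeg (comp n i fun j => l.getD (n + 1 + j) 1) L

theorem compList_initSeg {p : ℕ → A} {n L N i : ℕ} (hi : i < n) (hN : n + 1 + n * L ≤ N) :
    compList n L (initSeg p N) i = initSeg (comp n i fun j => p (n + 1 + j)) L := by
  refine List.map_congr_left fun j hj => ?_
  have hj' : n * (j + 1) ≤ n * L := Nat.mul_le_mul_left n (List.mem_range.1 hj)
  rw [comp, List.getD_eq_getElem?_getD, getElem?_initSeg (by lia), Option.getD_some, comp]

theorem primrec_compList [Primcodable A] {α : Type*} [Primcodable α] {n L i : α → ℕ}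
    {l : α → List A} (hn : Primrec n) (hL : Primrec L) (hl : Primrec l) (hi : Primrec i) :
    Primrec fun a => compList (n a) (L a) (l a) (i a) := by
  have hn' : Primrec fun x : α × ℕ => n x.1 := hn.comp Primrec.fst
  exact primrec_initSeg (p := fun a => comp (n a) (i a) fun j => (l a).getD (n a + 1 + j) 1)
    ((Primrec.list_getD 1).comp (hl.comp Primrec.fst)
    (Primrec.nat_add.comp (Primrec.succ.comp hn') (Primrec.nat_add.comp
      (Primrec.nat_mul.comp hn' Primrec.snd) (hi.comp Primrec.fst)))) hL

end Components

variable [Zero A] [One A]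

theorem idxOf_initSeg [NeZero (1 : A)] [DecidableEq A] {p : ℕ → A} {n : ℕ}
    (h1 : ∀ i < n, p i = 1) (h0 : p n = 0) (N : ℕ) : (initSeg p N).idxOf 0 = min n N := by
  rcases le_or_gt N n with hN | hN
  · have zero_notMem : (0 : A) ∉ initSeg p N := by
      simp only [initSeg, List.mem_map, List.mem_range, not_exists, not_and]
      exact fun i hi => by simp [h1 i (by lia)]
    rw [List.idxOf_eq_length zero_notMem, length_initSeg, min_eq_right hN]
  · rw [min_eq_left hN.le, List.idxOf, List.findIdx_eq (by simpa using hN)]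
    simp +contextual [initSeg, h0, h1]

section Encodable

variable [Encodable A]

/-- The prefix of the name of a binary product that is determined by prefixes of the same length
of the names of the two factors. -/
noncomputable def prodList (l₁ l₂ : List A) : List A :=
  (prodPrefix pairIndex (· = 2) (mergeList l₁ l₂)).take l₁.length

/-- The name of the product of the `m + 1` factors with the names `c 0, …, c m`. -/
noncomputable def finName (c : ℕ → ℕ → A) : ℕ → ℕ → A
  | 0 => c 0
  | m + 1 => prodName pairIndex (· = 2) (merge (finName c m) (c (m + 1)))

theorem prodList_initSeg (p q : ℕ → A) (n : ℕ) :
    prodList (initSeg p n) (initSeg q n) =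
      initSeg (prodName pairIndex (· = 2) (merge p q)) n := by
  rw [prodList, mergeList_initSeg _ _ le_rfl, prodPrefix_initSeg, length_initSeg,
    take_initSeg (by lia)]

theorem foldl_prodList (c : ℕ → ℕ → A) (L m : ℕ) :
    ((List.range m).map fun i => initSeg (c (i + 1)) L).foldl prodList (initSeg (c 0) L) =
      initSeg (finName c m) L := by
  induction m with
  | zero => rfl
  | succ m ih =>
    rw [List.range_succ, List.map_append, List.foldl_append, ih]
    exact prodList_initSeg _ _ _

theorem finProdAux_mem_finName [NeZero (1 : A)] {c : ℕ → ℕ → A} (m : ℕ)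
    (C : Fin (m + 1) → CompactPair.{u} A) (h : ∀ i : Fin (m + 1), C i ∈ kappaTildeDelta (c i)) :
    CompactPair.finProdAux m C ∈ kappaTildeDelta (finName c m) := by
  induction m with
  | zero => exact h 0
  | succ m ih =>
    refine prod_mem_prodName ?_ ?_
    · rw [comp_merge_zero]
      exact ih _ fun i => h i.castSucc
    · rw [comp_merge_one]
      exact h (Fin.last (m + 1))

variable [DecidableEq A]

/-- The length of the prefixes of `q₁, …, qₙ` that are determined by the prefix `l` of
`1ⁿ 0 ⟨q₁, …, qₙ⟩`. -/
def numRead (l : List A) : ℕ := (l.length - (l.idxOf 0 + 1)) / l.idxOf 0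

/-- The prefix of the name of a finite product that is determined by the prefix `l` of the
input. -/
noncomputable def finPrefix (l : List A) : List A :=
  ((List.range (l.idxOf 0 - 1)).map fun i =>
    compList (l.idxOf 0) (numRead l) l (i + 1)).foldl prodList
      (compList (l.idxOf 0) (numRead l) l 0)

theorem finPrefix_initSeg [NeZero (1 : A)] {p : ℕ → A} {m : ℕ} (h1 : ∀ i < m + 1, p i = 1)
    (h0 : p (m + 1) = 0) (N : ℕ) :
    finPrefix (initSeg p N) = initSeg (finName (fun i => comp (m + 1) i fun j =>
      p (m + 1 + 1 + j)) m) ((N - (m + 2)) / (m + 1)) := by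
  rcases le_or_gt N (m + 1) with hN | hN
  · have numRead_eq : numRead (initSeg p N) = 0 := by
      rw [numRead, idxOf_initSeg h1 h0, length_initSeg, min_eq_right hN, Nat.sub_self_add,
        Nat.zero_div]
    rw [finPrefix, numRead_eq, Nat.sub_eq_zero_of_le (by lia : N ≤ m + 2), Nat.zero_div]
    exact foldl_prodList (fun _ => p) 0 _
  · have idxOf_eq : (initSeg p N).idxOf 0 = m + 1 := by
      rw [idxOf_initSeg h1 h0]
      lia
    have numRead_eq : numRead (initSeg p N) = (N - (m + 2)) / (m + 1) := by
      rw [numRead, idxOf_eq, length_initSeg]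
    have hL := Nat.mul_div_le (N - (m + 2)) (m + 1)
    rw [finPrefix, idxOf_eq, numRead_eq, Nat.add_sub_cancel,
      compList_initSeg m.succ_pos (by lia), ← foldl_prodList]
    refine congrArg (List.foldl _ _) (List.map_congr_left fun i hi => ?_)
    rw [List.mem_range] at hi
    exact compList_initSeg (by lia) (by lia)

end Encodable

section Primrec

variable [NeZero (1 : A)] [Primcodable A]

theorem primrec_prodList : Primrec₂ (prodList : List A → List A → List A) :=
  Primrec.list_take.comp (Primrec.list_length.comp Primrec.fst)
    ((primrec_prodPrefix primrec_pairIndex primrecPred_eq_two).comp primrec_mergeList)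

variable [DecidableEq A]

theorem primrec_finPrefix : Primrec (finPrefix : List A → List A) := by
  have primrec_idxOf : Primrec fun l : List A => l.idxOf 0 :=
    Primrec.list_idxOf.comp (Primrec.const 0) Primrec.id
  have primrec_numRead : Primrec (numRead : List A → ℕ) :=
    Primrec.nat_div.comp (Primrec.nat_sub.comp Primrec.list_length
      (Primrec.succ.comp primrec_idxOf)) primrec_idxOf
  have primrec_compLists : Primrec fun l : List A => (List.range (l.idxOf 0 - 1)).map fun i =>
      compList (l.idxOf 0) (numRead l) l (i + 1) :=
    Primrec.list_map (Primrec.list_range.comp (Primrec.nat_sub.comp primrec_idxOf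
      (Primrec.const 1))) (primrec_compList (primrec_idxOf.comp Primrec.fst)
        (primrec_numRead.comp Primrec.fst) Primrec.fst (Primrec.succ.comp Primrec.snd))
  exact Primrec.list_foldl primrec_compLists
    (primrec_compList primrec_idxOf primrec_numRead Primrec.id (Primrec.const 0))
    (h := fun _ x => prodList x.1 x.2) (Primrec.comp₂ primrec_prodList Primrec₂.right)

end Primrec

theorem computableWrt_finProd [NeZero (1 : A)] [Finite A] [Primcodable A] :
    ComputableWrt (MultiRep.plus kappaTildeDelta) kappaTildeDelta
      (CompactPair.finProd.{u} (A := A) :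
        (Σ m : ℕ, Fin (m + 1) → CompactPair.{u} A) →. CompactPair.{u} A) := by
  classical
  refine computableWrt_of_initSeg primrec_finPrefix.to_comp fun p ⟨m, C⟩ ⟨h1, h0, hC⟩ y hy => ?_
  rw [PFun.coe_val, Part.mem_some_iff] at hy
  refine ⟨_, hy ▸ finProdAux_mem_finName m C hC, _, ?_, finPrefix_initSeg h1 h0⟩
  exact (Nat.tendsto_div_const_atTop m.succ_ne_zero).comp (Filter.tendsto_sub_atTop_nat (m + 2))

end FiniteProducts

end TTE

theorem corollary1 {A : Type} [Finite A] [Zero A] [One A] [NeZero (1 : A)] :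
    TTE.ComputableWrt
      (TTE.MultiRep.pair TTE.kappaTildeDelta TTE.kappaTildeDelta)
      TTE.kappaTildeDelta
      (TTE.CompactPair.prod.{u} (A := A) :
        TTE.CompactPair.{u} A × TTE.CompactPair.{u} A →. TTE.CompactPair.{u} A) ∧
    TTE.ComputableWrt
      (TTE.MultiRep.plus TTE.kappaTildeDelta)
      TTE.kappaTildeDelta
      (TTE.CompactPair.finProd.{u} (A := A) :
        (Σ m : ℕ, Fin (m + 1) → TTE.CompactPair.{u} A) →. TTE.CompactPair.{u} A) ∧
    TTE.ComputableWrt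
      (TTE.MultiRep.seq TTE.kappaTildeDelta)
      TTE.kappaTildeDelta
      (TTE.CompactPair.piNonempty.{u} (A := A)) := by
  obtain ⟨n, ⟨e⟩⟩ := Finite.exists_equiv_fin A
  let _ : Primcodable A := Primcodable.ofEquiv (Fin n) e
  exact ⟨TTE.computableWrt_prod, TTE.computableWrt_finProd, TTE.computableWrt_piNonempty⟩
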